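/- **Theorem (9-term functional equation for the complex trilogarithm).** Let $V$ be the space of all $(s_1,s_2)\in\mathbb C^2$ with $s_1s_2(1-s_1)(1-s_2)(s_1-s_2)(1-s_1s_2)\neq 0$ (the complement of the non-Fano arrangement), and let $\vec v$ be the tangential base point of $V$ over $(t^2,t)$, given by the germ at $t\to 0^+$ of the curve $t\mapsto(t^2,t)$. Define maps $f_1,\dots,f_9: V\to\mathbb P^1(\mathbb C)\setminus\{0,1,\infty\}$ by $$f_1=\frac{s_1(1-s_2)^2}{s_2(1-s_1)^2},\quad f_2=s_1s_2,\quad f_3=\frac{s_1}{s_2},\quad f_4=\frac{s_1(1-s_2)}{s_2(1-s_1)},\quad f_5=\frac{s_1(1-s_2)}{s_1-1},$$ $$f_6=\frac{1-s_2}{1-s_1},\quad f_7=\frac{1-s_2}{s_2(s_1-1)},\quad f_8=s_1,\quad f_9=s_2.$$ Let $\overrightarrow{01}$ be the standard tangential base point of $\mathbb P^1(\mathbb C)\setminus\{0,1,\infty\}$, given by $t\mapsto t$, and let $\delta_{\overrightarrow{10}}$ be the straight path along $(0,1)$ from $\overrightarrow{01}$ to $\overrightarrow{10}$. The tangential base points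 $f_i(\vec v)$ are given by the curves $t\mapsto f_i(t^2,t)$, that is $\frac{t}{(1+t)^2},\ t^3,\ t,\ \frac{t}{1+t},\ \frac{-t^2}{1+t},\ \frac1{1+t},\ \frac{-1}{t(1+t)},\ t^2,\ t$ for $i=1,\dots,9$. Let $\delta_i$ be the following homotopy class of paths on $\mathbb P^1(\mathbb C)\setminus\{0,1,\infty\}$ from $\overrightarrow{01}$ to $f_i(\vec v)$: the trivial path for $i=1,2,3,4,8,9$ (where $f_i(\vec v)$ has the direction of $\overrightarrow{01}$); $\delta_{\overrightarrow{10}}$ for $i=6$; the half turn around $0$ through the upper half plane, from $\overrightarrow{01}$ to $\overrightarrow{0\infty}$ (the negative real direction at $0$), for $i=5$; the path through the upper half plane from $\overrightarrow{01}$ to $\overrightarrow{\infty 0}$ (the direction at $\infty$ along the negative real axis) for $i=7$. For a homotopy class $\gamma$ of paths on $\mathbb P^1(\mathbb C)\setminus\{0,1,\infty\}$ from $\overrightarrow{01}$ to $z$ put $$\log(z;\gamma)=\int_{\delta_{\overrightarrow{10}}^{-1}\cdot\gamma}\frac{dt}{t},\qquad Li_1(z;\gamma)=\int_\gamma\frac{dt}{1-t},\qquad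 Li_k(z;\gamma)=\int_\gamma Li_{k-1}(t;\gamma_t)\,\frac{dt}{t}\quad(k\ge 2),$$ where $\gamma_t$ is the part of $\gamma$ up to $t$, and paths are composed from left to right. Let $(x,y)\in V$, let $\gamma_0$ be any homotopy class of paths on $V$ from $\vec v$ to $(x,y)$, and let $\gamma_i=\delta_i\cdot f_i(\gamma_0)$, a homotopy class of paths from $\overrightarrow{01}$ to $f_i(x,y)$, for $i=1,\dots,9$. Then $$\begin{aligned} &Li_3\!\left(\tfrac{x(1-y)^2}{y(1-x)^2};\gamma_1\right)+Li_3(xy;\gamma_2)+Li_3\!\left(\tfrac xy;\gamma_3\right)-2Li_3\!\left(\tfrac{x(1-y)}{y(1-x)};\gamma_4\right)-2Li_3\!\left(\tfrac{x(1-y)}{x-1};\gamma_5\right)\\ &-2Li_3\!\left(\tfrac{1-y}{1-x};\gamma_6\right)-2Li_3\!\left(\tfrac{1-y}{y(x-1)};\gamma_7\right)-2Li_3(x;\gamma_8)-2Li_3(y;\gamma_9)+2\zeta(3)\\ &\qquad=\log^2(y;\gamma_9)\,\log\!\left(\tfrac{1-y}{1-x};\gamma_6\right)-\frac{\pi^2}{3}\log(y;\gamma_9)-\frac13\log^3(y;\gamma_9).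 \end{aligned}$$ -/

import Mathlib

open Set

noncomputable section

namespace SpenceKummer

/-! ### Homotopy classes of paths with tangential base points

A tangential base point of a space `X` is given by a germ at `t → 0⁺` of a continuous curve
`t ↦ c t` in `X`; here all germs are defined for every `t` in the interval `(0, 1)`. -/

/-- Domain of the curves that give tangential base points. -/
abbrev UnitOpen : Type := Ioo (0 : ℝ) 1

section Tangential

variable {X Y : Type*} [TopologicalSpace X] [TopologicalSpace Y]

/-- `TangentialPath c z` is `π₁(X; c, z)`, the set of homotopy classes of paths from the tangential
base point given by `c` to the point `z`: the limit over `ε → 0` of the sets of homotopy classes of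
paths from `c ε` to `z` along the bijections given by moving the starting point along the
curve `c`. So an element is a family of homotopy classes, one for each starting point `c ε`, which
is compatible with moving `ε` in the (contractible) interval `(0, 1)`. -/
structure TangentialPath (c : C(UnitOpen, X)) (z : X) where
  /-- the homotopy class of the part of the path that starts at `c ε` -/
  cls : ∀ ε : UnitOpen, Path.Homotopic.Quotient (c ε) z
  compat : ∀ (ε ε' : UnitOpen) (q : Path ε ε'),
    cls ε = (Path.Homotopic.Quotient.mk (q.map c.continuous)).trans (cls ε')

/-- The image of a homotopy class of paths under a continuous map. -/
def TangentialPath.map {c : C(UnitOpen, X)} {z : X} (γ : TangentialPath c z) (f : C(X, Y)) :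
    TangentialPath (f.comp c) (f z) where
  cls ε := (γ.cls ε).map f
  compat ε ε' q := by
    rw [γ.compat ε ε' q]
    induction γ.cls ε' using Path.Homotopic.Quotient.ind with
    | mk p =>
      rw [← Path.Homotopic.Quotient.mk_trans, ← Path.Homotopic.Quotient.mk_map, Path.map_trans]
      rfl

/-- `TangentialConnection a b` is `π₁(X; a, b)`, the set of homotopy classes of paths from the
tangential base point given by `a` to the one given by `b`: families of homotopy classes of
paths from `a ε` to `b ε'`, compatible with moving both ends along the two curves. -/
structure TangentialConnection (a b : C(UnitOpen, X)) where
  /-- the homotopy class of the part of the path from `a ε` to `b ε'` -/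
  cls : ∀ ε ε' : UnitOpen, Path.Homotopic.Quotient (a ε) (b ε')
  compat_left : ∀ (ε₁ ε₂ ε' : UnitOpen) (q : Path ε₁ ε₂),
    cls ε₁ ε' = (Path.Homotopic.Quotient.mk (q.map a.continuous)).trans (cls ε₂ ε')
  compat_right : ∀ (ε ε₁ ε₂ : UnitOpen) (q : Path ε₁ ε₂),
    cls ε ε₂ = (cls ε ε₁).trans (Path.Homotopic.Quotient.mk (q.map b.continuous))

/-- The point `1/2` of `(0, 1)`. -/
def half : UnitOpen := ⟨1 / 2, by norm_num, by norm_num⟩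

theorem trans_assoc {w x y z : X} (p : Path.Homotopic.Quotient w x)
    (q : Path.Homotopic.Quotient x y) (r : Path.Homotopic.Quotient y z) :
    (p.trans q).trans r = p.trans (q.trans r) := by
  induction p using Path.Homotopic.Quotient.ind with
  | mk p =>
    induction q using Path.Homotopic.Quotient.ind with
    | mk q =>
      induction r using Path.Homotopic.Quotient.ind with
      | mk r =>
        exact Path.Homotopic.Quotient.eq.2 ⟨Path.Homotopy.transAssoc p q r⟩

/-- The composite `δ · γ` (first `δ`, then `γ`). Going from `δ` over to `γ` may be done at any
point `b ε'` of the curve in the middle: see `comp_cls`. -/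
def TangentialConnection.comp {a b : C(UnitOpen, X)} {z : X} (δ : TangentialConnection a b)
    (γ : TangentialPath b z) : TangentialPath a z where
  cls ε := (δ.cls ε half).trans (γ.cls half)
  compat ε ε' q := by rw [δ.compat_left ε ε' half q, trans_assoc]

theorem TangentialConnection.comp_cls {a b : C(UnitOpen, X)} {z : X}
    (δ : TangentialConnection a b) (γ : TangentialPath b z) (ε ε' : UnitOpen) :
    (δ.comp γ).cls ε = (δ.cls ε ε').trans (γ.cls ε') := by
  have : ContractibleSpace UnitOpen :=
    Convex.contractibleSpace (convex_Ioo 0 1) ⟨1 / 2, by norm_num, by norm_num⟩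
  let q : Path half ε' := PathConnectedSpace.somePath half ε'
  change (δ.cls ε half).trans (γ.cls half) = _
  rw [γ.compat half ε' q, ← trans_assoc, ← δ.compat_right ε half ε' q]

/-- The straight segment from `u` to `v` in a convex set. -/
def segmentPath {E : Type*} [NormedAddCommGroup E] [NormedSpace ℝ E] {W : Set E}
    (hW : Convex ℝ W) (u v : W) : Path u v where
  toFun s := ⟨AffineMap.lineMap (u : E) (v : E) (s : ℝ),
    hW.segment_subset u.2 v.2 (by
      rw [segment_eq_image_lineMap]
      exact ⟨s, s.2, rfl⟩)⟩
  continuous_toFun := by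
    refine Continuous.subtype_mk ?_ _
    exact AffineMap.lineMap_continuous.comp continuous_subtype_val
  source' := by simp
  target' := by simp

/-- Let `e : W → X` be a continuous map on a convex set `W`. If the curves that give two
tangential base points lift to `W`, then the image under `e` of the straight segments in `W` is
a path from the first tangential base point to the second. -/
def TangentialConnection.ofConvex {E : Type*} [NormedAddCommGroup E] [NormedSpace ℝ E] {W : Set E}
    (hW : Convex ℝ W) (e : C(W, X)) (α β : C(UnitOpen, W)) {a b : C(UnitOpen, X)}
    (ha : a = e.comp α) (hb : b = e.comp β) : TangentialConnection a b where
  cls ε ε' := Path.Homotopic.Quotient.mk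
    (((segmentPath hW (α ε) (β ε')).map e.continuous).cast (by rw [ha]; rfl) (by rw [hb]; rfl))
  compat_left ε₁ ε₂ ε' q := by
    subst ha hb
    have : ContractibleSpace W := Convex.contractibleSpace hW ⟨_, (α half).2⟩
    rw [← Path.Homotopic.Quotient.mk_trans]
    refine Path.Homotopic.Quotient.eq.2 ?_
    have h := (SimplyConnectedSpace.paths_homotopic (segmentPath hW (α ε₁) (β ε'))
      ((q.map α.continuous).trans (segmentPath hW (α ε₂) (β ε')))).map e
    rw [Path.map_trans] at h
    exact h
  compat_right ε ε₁ ε₂ q := by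
    subst ha hb
    have : ContractibleSpace W := Convex.contractibleSpace hW ⟨_, (α half).2⟩
    rw [← Path.Homotopic.Quotient.mk_trans]
    refine Path.Homotopic.Quotient.eq.2 ?_
    have h := (SimplyConnectedSpace.paths_homotopic (segmentPath hW (α ε) (β ε₂))
      ((segmentPath hW (α ε) (β ε₁)).trans (q.map β.continuous))).map e
    rw [Path.map_trans] at h
    exact h

end Tangential

/-! ### The projective line minus three points -/

/-- `ℙ¹(ℂ) ∖ {0, 1, ∞}`. -/
abbrev Line : Type := {z : ℂ // z ≠ 0 ∧ z ≠ 1}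

/-- The standard tangential base point `01` of `ℙ¹ ∖ {0, 1, ∞}`, given by the curve `t ↦ t`. -/
def base01 : C(UnitOpen, Line) where
  toFun t := ⟨((t : ℝ) : ℂ), by exact_mod_cast t.2.1.ne', by exact_mod_cast t.2.2.ne⟩
  continuous_toFun := by
    refine Continuous.subtype_mk ?_ _
    exact Complex.continuous_ofReal.comp continuous_subtype_val

/-- For a tangential base point given by a curve `b` in the unit interval `(0, 1)`: the path from
`01` to `b` along `(0, 1)`. If `b t → 0` for `t → 0`, it is the trivial path; if `b t → 1`, it
is the straight path from `01` to `10`. -/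
def deltaUnit (b : C(UnitOpen, Line))
    (hb : ∀ t, (b t : ℂ).im = 0 ∧ 0 < (b t : ℂ).re ∧ (b t : ℂ).re < 1) :
    TangentialConnection base01 b :=
  TangentialConnection.ofConvex (convex_Ioo (0 : ℝ) 1) base01 (ContinuousMap.id UnitOpen)
    { toFun := fun t => ⟨(b t : ℂ).re, (hb t).2⟩
      continuous_toFun := by
        refine Continuous.subtype_mk ?_ _
        exact Complex.continuous_re.comp (continuous_subtype_val.comp b.continuous) }
    (by ext t; rfl)
    (by
      ext t
      change (b t : ℂ) = (((b t : ℂ).re : ℝ) : ℂ)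
      apply Complex.ext <;> simp [(hb t).1])

/-- The convex set `{w | 0 < Im w < π} ∪ (-∞, 0) ∪ (ℝ + π i)`. The exponential function maps it
bijectively to `{z | 0 < Im z} ∪ (0, 1) ∪ (-∞, 0)`. -/
def strip : Set ℂ := {w | 0 ≤ w.im ∧ w.im ≤ Real.pi ∧ (w.im = 0 → w.re < 0)}

theorem convex_strip : Convex ℝ strip := by
  rintro u ⟨hu0, hu1, hu2⟩ v ⟨hv0, hv1, hv2⟩ a b ha hb hab
  refine ⟨?_, ?_, ?_⟩
  · simp; positivity
  · simp
    calc a * u.im + b * v.im ≤ a * Real.pi + b * Real.pi := by gcongr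
      _ = Real.pi := by rw [← add_mul, hab, one_mul]
  · simp
    intro h
    have h1 : 0 ≤ a * u.im := by positivity
    have h2 : 0 ≤ b * v.im := by positivity
    have h3 : a * u.im = 0 := by linarith
    have h4 : b * v.im = 0 := by linarith
    rcases ha.eq_or_lt with rfl | ha'
    · have : b = 1 := by linarith
      subst this
      have := hv2 (by simpa using h4)
      simpa using this
    · have hu := hu2 ((mul_eq_zero.1 h3).resolve_left ha'.ne')
      rcases hb.eq_or_lt with rfl | hb'
      · have := mul_neg_of_pos_of_neg ha' hu
        simpa using this
      · have hv := hv2 ((mul_eq_zero.1 h4).resolve_left hb'.ne')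
        have := mul_neg_of_pos_of_neg ha' hu
        have := mul_neg_of_pos_of_neg hb' hv
        linarith

/-- The exponential function from `strip` to `ℙ¹ ∖ {0, 1, ∞}`. -/
def expStrip : C(strip, Line) where
  toFun w := ⟨Complex.exp w, Complex.exp_ne_zero _, by
    obtain ⟨w, h0, h1, h2⟩ := w
    intro h
    obtain ⟨n, hn⟩ := Complex.exp_eq_one_iff.1 h
    have him : w.im = n * (2 * Real.pi) := by
      have := congrArg Complex.im hn
      simpa using this
    have hre : w.re = 0 := by
      have := congrArg Complex.re hn
      simpa using this
    have hpi := Real.pi_pos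
    have hn0 : n = 0 := by
      have a1 : (-1 : ℝ) < n := by
        by_contra hc
        push Not at hc
        nlinarith
      have a2 : (n : ℝ) < 1 := by
        by_contra hc
        push Not at hc
        nlinarith
      have b1 : -1 < n := by exact_mod_cast a1
      have b2 : n < 1 := by exact_mod_cast a2
      omega
    have := h2 (by rw [him, hn0]; simp)
    linarith⟩
  continuous_toFun := by
    refine Continuous.subtype_mk ?_ _
    exact Complex.continuous_exp.comp continuous_subtype_val

/-- For a tangential base point given by a curve `b` in `(-∞, 0)`: the path from `01` to `b`
through the upper half plane. It is represented by the arcs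
`s ↦ exp ((1 - s) log ε + s (log |b ε'| + π i))` from `ε` to `b ε'`.
If `b t → 0` for `t → 0`, it is the half turn around `0` from `01` to `0∞`; if `b t → ∞`, it is
the path from `01` to `∞0` through the upper half plane. -/
def deltaUpper (b : C(UnitOpen, Line))
    (hb : ∀ t, (b t : ℂ).im = 0 ∧ (b t : ℂ).re < 0) :
    TangentialConnection base01 b :=
  TangentialConnection.ofConvex convex_strip expStrip
    { toFun := fun t => ⟨((Real.log t : ℝ) : ℂ), by simp, by simpa using Real.pi_pos.le,
        fun _ => by simpa using Real.log_neg t.2.1 t.2.2⟩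
      continuous_toFun := by
        refine Continuous.subtype_mk ?_ _
        exact Complex.continuous_ofReal.comp
          (continuous_subtype_val.log fun t => t.2.1.ne') }
    { toFun := fun t => ⟨((Real.log (-(b t : ℂ).re) : ℝ) : ℂ) + Real.pi * Complex.I,
        by simpa using Real.pi_pos.le, by simp,
        fun h => by simp at h⟩
      continuous_toFun := by
        refine Continuous.subtype_mk ?_ _
        refine (Complex.continuous_ofReal.comp (Continuous.log ?_ fun t => ?_)).add
          continuous_const
        · exact (Complex.continuous_re.comp (continuous_subtype_val.comp b.continuous)).neg
        · exact (neg_pos.2 (hb t).2).ne' }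
    (by
      ext t
      change ((t : ℝ) : ℂ) = Complex.exp ((Real.log t : ℝ) : ℂ)
      rw [← Complex.ofReal_exp, Real.exp_log t.2.1])
    (by
      ext t
      change (b t : ℂ) = Complex.exp (((Real.log (-(b t : ℂ).re) : ℝ) : ℂ) + Real.pi * Complex.I)
      rw [Complex.exp_add, Complex.exp_pi_mul_I, ← Complex.ofReal_exp,
        Real.exp_log (neg_pos.2 (hb t).2)]
      apply Complex.ext <;> simp [(hb t).1])

/-! ### Logarithm and polylogarithms as iterated integrals along paths from `01` -/

/-- A path in `ℙ¹(ℂ) ∖ {0, 1, ∞}` as a function `ℝ → ℂ` (constant outside of `[0, 1]`). -/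
def curve {a b : Line} (p : Path a b) (t : ℝ) : ℂ := (p.extend t : ℂ)

/-- Piecewise continuously differentiable, with bounded derivative. -/
def IsPiecewiseC1 {a b : Line} (p : Path a b) : Prop :=
  ∃ (S : Finset ℝ) (M : ℝ), ∀ t ∈ Ioo (0 : ℝ) 1, t ∉ S →
    ContDiffAt ℝ 1 (curve p) t ∧ ‖deriv (curve p) t‖ ≤ M

/-- The iterated integrals along the initial segment `(0, t]` of the interval `(0, 1)`:
`Li₁(t) = ∫₀ᵗ du / (1 - u)` and `Li_k(t) = ∫₀ᵗ Li_{k-1}(u) du / u` for `k ≥ 2`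
(and the rational function `t / (1 - t)` for `k = 0`). -/
def polylogStart : ℕ → ℝ → ℝ
  | 0 => fun t => t / (1 - t)
  | 1 => fun t => ∫ u in (0 : ℝ)..t, 1 / (1 - u)
  | (k + 2) => fun t => ∫ u in (0 : ℝ)..t, polylogStart (k + 1) u / u

/-- The iterated integral `Li_k` along the path which follows `(0, ε]` and then `p` up to `p s`:
`Li₁ = ∫ dz / (1 - z)`, and `Li_k = ∫ Li_{k-1} dz / z` for `k ≥ 2`. -/
def polylogAlong {ε : UnitOpen} {z : Line} (p : Path (base01 ε) z) : ℕ → ℝ → ℂ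
  | 0 => fun s => curve p s / (1 - curve p s)
  | 1 => fun s => (polylogStart 1 ε : ℂ) +
      ∫ u in (0 : ℝ)..s, deriv (curve p) u / (1 - curve p u)
  | (k + 2) => fun s => (polylogStart (k + 2) ε : ℂ) +
      ∫ u in (0 : ℝ)..s, polylogAlong p (k + 1) u * deriv (curve p) u / curve p u

/-- The integral of `dz / z` along the path from `1` straight to `ε` (the inverse of the
straight path from `01` to `10`, up to `ε`), followed by `p`. -/
def logAlong {ε : UnitOpen} {z : Line} (p : Path (base01 ε) z) : ℂ :=
  ((∫ u in (1 : ℝ)..(ε : ℝ), 1 / u : ℝ) : ℂ) + ∫ u in (0 : ℝ)..1, deriv (curve p) u / curve p u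

/-- Every homotopy class of paths in `ℙ¹(ℂ) ∖ {0, 1, ∞}` has a piecewise `C¹` representative. -/
theorem exists_isPiecewiseC1 {a b : Line} (c : Path.Homotopic.Quotient a b) :
    ∃ p : Path a b, IsPiecewiseC1 p ∧ Path.Homotopic.Quotient.mk p = c := by
  induction c using Path.Homotopic.Quotient.ind with
  | mk p =>
    -- the distance of the path from the points `0` and `1`
    obtain ⟨d, hd, hdist⟩ : ∃ d : ℝ, 0 < d ∧
        ∀ s : unitInterval, d ≤ ‖(p s : ℂ)‖ ∧ d ≤ ‖(p s : ℂ) - 1‖ := by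
      have hc : Continuous fun s : unitInterval => min ‖(p s : ℂ)‖ ‖(p s : ℂ) - 1‖ := by fun_prop
      obtain ⟨s₀, -, hs₀⟩ := isCompact_univ.exists_isMinOn (s := (univ : Set unitInterval))
        ⟨0, mem_univ _⟩ hc.continuousOn
      refine ⟨min ‖(p s₀ : ℂ)‖ ‖(p s₀ : ℂ) - 1‖, ?_, fun s => ?_⟩
      · exact lt_min (norm_pos_iff.2 (p s₀).2.1) (norm_pos_iff.2 (sub_ne_zero.2 (p s₀).2.2))
      · exact le_min_iff.1 (hs₀ (mem_univ s))
    have hcurve : Continuous (curve p) := continuous_subtype_val.comp p.continuous_extend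
    obtain ⟨P, hP⟩ := exists_polynomial_near_of_continuousOn 0 1 (fun t => (curve p t).re)
      (Complex.continuous_re.comp hcurve).continuousOn (d / 8) (by positivity)
    obtain ⟨Q, hQ⟩ := exists_polynomial_near_of_continuousOn 0 1 (fun t => (curve p t).im)
      (Complex.continuous_im.comp hcurve).continuousOn (d / 8) (by positivity)
    let g : ℝ → ℂ := fun t => ((P.eval t : ℝ) : ℂ) + ((Q.eval t : ℝ) : ℂ) * Complex.I
    have hg : ∀ t ∈ Icc (0 : ℝ) 1, ‖g t - curve p t‖ < d / 4 := by
      intro t ht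
      have h1 := hP t ht
      have h2 := hQ t ht
      have h3 := Complex.norm_le_abs_re_add_abs_im (g t - curve p t)
      simp only [g, Complex.sub_re, Complex.sub_im, Complex.add_re, Complex.add_im,
        Complex.ofReal_re, Complex.ofReal_im, Complex.mul_re, Complex.mul_im, Complex.I_re,
        Complex.I_im, mul_zero, mul_one, sub_zero, add_zero, zero_add] at h3
      simp only [g]
      linarith
    let r : ℝ → ℂ := fun t =>
      g t + (((1 - t : ℝ) : ℂ) * ((a : ℂ) - g 0) + ((t : ℝ) : ℂ) * ((b : ℂ) - g 1))
    have hgd : ContDiff ℝ 1 g := by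
      have h1 : ContDiff ℝ 1 fun t : ℝ => P.eval t := by simpa using P.contDiff_aeval (R := ℝ) (𝕜 := ℝ) 1
      have h2 : ContDiff ℝ 1 fun t : ℝ => Q.eval t := by simpa using Q.contDiff_aeval (R := ℝ) (𝕜 := ℝ) 1
      exact (Complex.ofRealCLM.contDiff.comp h1).add
        ((Complex.ofRealCLM.contDiff.comp h2).mul contDiff_const)
    have hrd : ContDiff ℝ 1 r := by
      have h1 : ContDiff ℝ 1 fun t : ℝ => (1 - t : ℝ) := contDiff_const.sub contDiff_id
      have h2 : ContDiff ℝ 1 fun t : ℝ => t := contDiff_id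
      exact hgd.add (((Complex.ofRealCLM.contDiff.comp h1).mul contDiff_const).add
        ((Complex.ofRealCLM.contDiff.comp h2).mul contDiff_const))
    have ha : curve p 0 = a := by simp [curve]
    have hb : curve p 1 = b := by simp [curve]
    have hr : ∀ t ∈ Icc (0 : ℝ) 1, ‖r t - curve p t‖ < d := by
      intro t ht
      have h0 := hg 0 ⟨le_rfl, zero_le_one⟩
      have h1 := hg 1 ⟨zero_le_one, le_rfl⟩
      have h2 := hg t ht
      rw [ha, norm_sub_rev] at h0
      rw [hb, norm_sub_rev] at h1
      have e : r t - curve p t = (g t - curve p t) +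
          (((1 - t : ℝ) : ℂ) * ((a : ℂ) - g 0) + ((t : ℝ) : ℂ) * ((b : ℂ) - g 1)) := by
        simp only [r]; ring
      have n1 : ‖((1 - t : ℝ) : ℂ) * ((a : ℂ) - g 0)‖ ≤ 1 * (d / 4) := by
        rw [norm_mul, Complex.norm_real, Real.norm_of_nonneg (by linarith [ht.2])]
        exact mul_le_mul (by linarith [ht.1]) h0.le (norm_nonneg _) zero_le_one
      have n2 : ‖((t : ℝ) : ℂ) * ((b : ℂ) - g 1)‖ ≤ 1 * (d / 4) := by
        rw [norm_mul, Complex.norm_real, Real.norm_of_nonneg ht.1]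
        exact mul_le_mul ht.2 h1.le (norm_nonneg _) zero_le_one
      rw [e]
      have n3 := norm_add_le (g t - curve p t)
        (((1 - t : ℝ) : ℂ) * ((a : ℂ) - g 0) + ((t : ℝ) : ℂ) * ((b : ℂ) - g 1))
      have n4 := norm_add_le (((1 - t : ℝ) : ℂ) * ((a : ℂ) - g 0)) (((t : ℝ) : ℂ) * ((b : ℂ) - g 1))
      linarith
    -- the segments between the two paths avoid `0` and `1`
    have key : ∀ (u t : unitInterval),
        (p t : ℂ) + ((u : ℝ) : ℂ) * (r t - p t) ≠ 0 ∧
        (p t : ℂ) + ((u : ℝ) : ℂ) * (r t - p t) ≠ 1 := by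
      intro u t
      have h1 := hr t t.2
      have h2 : curve p (t : ℝ) = p t := by simp [curve]
      rw [h2] at h1
      have h3 : ‖((u : ℝ) : ℂ) * (r t - p t)‖ < d := by
        rw [norm_mul, Complex.norm_real, Real.norm_of_nonneg u.2.1]
        calc (u : ℝ) * ‖r t - p t‖ ≤ 1 * ‖r t - p t‖ :=
              mul_le_mul_of_nonneg_right u.2.2 (norm_nonneg _)
          _ < d := by rw [one_mul]; exact h1
      refine ⟨fun h => ?_, fun h => ?_⟩
      · have e : ((u : ℝ) : ℂ) * (r t - p t) = -(p t : ℂ) := by linear_combination h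
        rw [e, norm_neg] at h3
        linarith [(hdist t).1]
      · have e : ((u : ℝ) : ℂ) * (r t - p t) = -((p t : ℂ) - 1) := by linear_combination h
        rw [e, norm_neg] at h3
        linarith [(hdist t).2]
    have hr0 : r 0 = a := by simp [r]
    have hr1 : r 1 = b := by simp [r]
    let q : Path a b :=
      { toFun := fun t => ⟨r t, by
          have := key 1 t
          simpa using this⟩
        continuous_toFun := by
          refine Continuous.subtype_mk ?_ _
          exact hrd.continuous.comp continuous_subtype_val
        source' := Subtype.ext (by simpa using hr0)
        target' := Subtype.ext (by simpa using hr1) }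
    have hq : ∀ t : unitInterval, (q t : ℂ) = r t := fun t => rfl
    refine ⟨q, ?_, ?_⟩
    · have hder : Continuous (deriv r) := hrd.continuous_deriv le_rfl
      obtain ⟨M, hM⟩ := isCompact_Icc.exists_bound_of_continuousOn
        (s := Icc (0 : ℝ) 1) hder.continuousOn
      refine ⟨∅, M, fun t ht _ => ?_⟩
      have hev : curve q =ᶠ[nhds t] r := by
        filter_upwards [Ioo_mem_nhds ht.1 ht.2] with u hu
        simp only [curve]
        rw [Path.extend_apply q ⟨hu.1.le, hu.2.le⟩]
        exact hq _
      refine ⟨hrd.contDiffAt.congr_of_eventuallyEq hev, ?_⟩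
      rw [hev.deriv_eq]
      exact hM t ⟨ht.1.le, ht.2.le⟩
    · refine (Path.Homotopic.Quotient.eq.2 ⟨?_⟩).symm
      exact
        { toFun := fun x => ⟨(p x.2 : ℂ) + ((x.1 : ℝ) : ℂ) * (r x.2 - p x.2), key x.1 x.2⟩
          continuous_toFun := by
            refine Continuous.subtype_mk ?_ _
            have h1 : Continuous fun x : unitInterval × unitInterval => r (x.2 : ℝ) :=
              hrd.continuous.comp (continuous_subtype_val.comp continuous_snd)
            have h2 : Continuous fun x : unitInterval × unitInterval => (((x.1 : ℝ)) : ℂ) :=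
              Complex.continuous_ofReal.comp (continuous_subtype_val.comp continuous_fst)
            have h3 : Continuous fun x : unitInterval × unitInterval => (p x.2 : ℂ) :=
              continuous_subtype_val.comp (p.continuous.comp continuous_snd)
            exact h3.add (h2.mul (h1.sub h3))
          map_zero_left := fun t => Subtype.ext (by simp)
          map_one_left := fun t => Subtype.ext (by simp [hq])
          prop' := fun u t ht => by
            rcases ht with rfl | ht
            · exact Subtype.ext (by simp [hr0])
            · rw [mem_singleton_iff] at ht
              subst ht
              exact Subtype.ext (by simp [hr1]) }

/-- A piecewise `C¹` path, from the point `1/2` of the curve `01` to `z`, which represents `γ`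
(following the interval `(0, 1/2]`). -/
def representative {z : Line} (γ : TangentialPath base01 z) : Path (base01 half) z :=
  (exists_isPiecewiseC1 (γ.cls half)).choose

/-- The polylogarithm `Li_k(z; γ)`, for a homotopy class `γ` of paths from `01` to `z`. -/
def Li (k : ℕ) (z : Line) (γ : TangentialPath base01 z) : ℂ :=
  polylogAlong (representative γ) k 1

/-- The logarithm `log(z; γ)`, for a homotopy class `γ` of paths from `01` to `z`. -/
def log (z : Line) (γ : TangentialPath base01 z) : ℂ :=
  logAlong (representative γ)

/-! ### The complement of the non-Fano arrangement and the nine maps -/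

/-- The complex points of the complement of the non-Fano arrangement. -/
abbrev NonFano : Type :=
  {s : ℂ × ℂ // s.1 * s.2 * (1 - s.1) * (1 - s.2) * (s.1 - s.2) * (1 - s.1 * s.2) ≠ 0}

theorem NonFano.ne (s : NonFano) : s.1.1 ≠ 0 ∧ s.1.2 ≠ 0 ∧ 1 - s.1.1 ≠ 0 ∧ 1 - s.1.2 ≠ 0 ∧
    s.1.1 - s.1.2 ≠ 0 ∧ 1 - s.1.1 * s.1.2 ≠ 0 := by
  have h := s.2
  simp only [mul_ne_zero_iff] at h
  tauto

theorem NonFano.ne' (s : NonFano) : s.1.1 - 1 ≠ 0 := by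
  rw [← neg_sub]
  exact neg_ne_zero.2 s.ne.2.2.1

theorem NonFano.continuous_s₁ : Continuous fun s : NonFano => s.1.1 :=
  continuous_fst.comp continuous_subtype_val

theorem NonFano.continuous_s₂ : Continuous fun s : NonFano => s.1.2 :=
  continuous_snd.comp continuous_subtype_val

/-- The tangential base point `v` over `(t², t)`. -/
def baseV : C(UnitOpen, NonFano) where
  toFun t := ⟨(((t : ℝ) : ℂ) ^ 2, ((t : ℝ) : ℂ)), by
    obtain ⟨t, h0, h1⟩ := t
    have e1 : 1 - t ^ 2 ≠ 0 := by nlinarith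
    have e2 : t ^ 2 - t ≠ 0 := by nlinarith
    have e3 : 1 - t ^ 2 * t ≠ 0 := by nlinarith [mul_pos h0 h0]
    have e4 : 1 - t ≠ 0 := by linarith
    have e : t ^ 2 * t * (1 - t ^ 2) * (1 - t) * (t ^ 2 - t) * (1 - t ^ 2 * t) ≠ 0 := by
      simp only [mul_ne_zero_iff]
      exact ⟨⟨⟨⟨⟨pow_ne_zero _ h0.ne', h0.ne'⟩, e1⟩, e4⟩, e2⟩, e3⟩
    have e' := Complex.ofReal_ne_zero.2 e
    push_cast at e'
    exact e'⟩
  continuous_toFun := by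
    refine Continuous.subtype_mk ?_ _
    have : Continuous fun t : UnitOpen => ((t : ℝ) : ℂ) :=
      Complex.continuous_ofReal.comp continuous_subtype_val
    fun_prop

set_option linter.unusedSimpArgs false

/-- `s₁ (1 - s₂)² / (s₂ (1 - s₁)²)` -/
def f₁ : C(NonFano, Line) where
  toFun s := ⟨s.1.1 * (1 - s.1.2) ^ 2 / (s.1.2 * (1 - s.1.1) ^ 2), by
    obtain ⟨h1, h2, h3, h4, h5, h6⟩ := s.ne
    have h7 := s.ne'
    exact ⟨by simp [h1, h2, h3, h4, h7], by
        rw [Ne, div_eq_one_iff_eq (by simp [h1, h2, h3, h4, h7])]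
        intro h
        exact mul_ne_zero h5 h6 (by linear_combination h)⟩⟩
  continuous_toFun := by
    refine Continuous.subtype_mk ?_ _
    have c1 := NonFano.continuous_s₁
    have c2 := NonFano.continuous_s₂
    refine Continuous.div (by fun_prop) (by fun_prop) fun s => ?_
    obtain ⟨h1, h2, h3, h4, -, -⟩ := s.ne
    have h7 := s.ne'
    simp [h1, h2, h3, h4, h7]

/-- `s₁ s₂` -/
def f₂ : C(NonFano, Line) where
  toFun s := ⟨s.1.1 * s.1.2, by
    obtain ⟨h1, h2, h3, h4, h5, h6⟩ := s.ne
    have h7 := s.ne'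
    exact ⟨by simp [h1, h2, h3, h4, h7], fun h => h6 (by rw [h, sub_self])⟩⟩
  continuous_toFun := by
    refine Continuous.subtype_mk ?_ _
    have c1 := NonFano.continuous_s₁
    have c2 := NonFano.continuous_s₂
    fun_prop

/-- `s₁ / s₂` -/
def f₃ : C(NonFano, Line) where
  toFun s := ⟨s.1.1 / s.1.2, by
    obtain ⟨h1, h2, h3, h4, h5, h6⟩ := s.ne
    have h7 := s.ne'
    exact ⟨by simp [h1, h2, h3, h4, h7], by
        rw [Ne, div_eq_one_iff_eq (by simp [h1, h2, h3, h4, h7])]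
        intro h
        exact h5 (by linear_combination h)⟩⟩
  continuous_toFun := by
    refine Continuous.subtype_mk ?_ _
    have c1 := NonFano.continuous_s₁
    have c2 := NonFano.continuous_s₂
    refine Continuous.div (by fun_prop) (by fun_prop) fun s => ?_
    obtain ⟨h1, h2, h3, h4, -, -⟩ := s.ne
    have h7 := s.ne'
    simp [h1, h2, h3, h4, h7]

/-- `s₁ (1 - s₂) / (s₂ (1 - s₁))` -/
def f₄ : C(NonFano, Line) where
  toFun s := ⟨s.1.1 * (1 - s.1.2) / (s.1.2 * (1 - s.1.1)), by
    obtain ⟨h1, h2, h3, h4, h5, h6⟩ := s.ne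
    have h7 := s.ne'
    exact ⟨by simp [h1, h2, h3, h4, h7], by
        rw [Ne, div_eq_one_iff_eq (by simp [h1, h2, h3, h4, h7])]
        intro h
        exact h5 (by linear_combination h)⟩⟩
  continuous_toFun := by
    refine Continuous.subtype_mk ?_ _
    have c1 := NonFano.continuous_s₁
    have c2 := NonFano.continuous_s₂
    refine Continuous.div (by fun_prop) (by fun_prop) fun s => ?_
    obtain ⟨h1, h2, h3, h4, -, -⟩ := s.ne
    have h7 := s.ne'
    simp [h1, h2, h3, h4, h7]

/-- `s₁ (1 - s₂) / (s₁ - 1)` -/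
def f₅ : C(NonFano, Line) where
  toFun s := ⟨s.1.1 * (1 - s.1.2) / (s.1.1 - 1), by
    obtain ⟨h1, h2, h3, h4, h5, h6⟩ := s.ne
    have h7 := s.ne'
    exact ⟨by simp [h1, h2, h3, h4, h7], by
        rw [Ne, div_eq_one_iff_eq (by simp [h1, h2, h3, h4, h7])]
        intro h
        exact h6 (by linear_combination h)⟩⟩
  continuous_toFun := by
    refine Continuous.subtype_mk ?_ _
    have c1 := NonFano.continuous_s₁
    have c2 := NonFano.continuous_s₂
    refine Continuous.div (by fun_prop) (by fun_prop) fun s => ?_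
    obtain ⟨h1, h2, h3, h4, -, -⟩ := s.ne
    have h7 := s.ne'
    simp [h1, h2, h3, h4, h7]

/-- `(1 - s₂) / (1 - s₁)` -/
def f₆ : C(NonFano, Line) where
  toFun s := ⟨(1 - s.1.2) / (1 - s.1.1), by
    obtain ⟨h1, h2, h3, h4, h5, h6⟩ := s.ne
    have h7 := s.ne'
    exact ⟨by simp [h1, h2, h3, h4, h7], by
        rw [Ne, div_eq_one_iff_eq (by simp [h1, h2, h3, h4, h7])]
        intro h
        exact h5 (by linear_combination h)⟩⟩
  continuous_toFun := by
    refine Continuous.subtype_mk ?_ _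
    have c1 := NonFano.continuous_s₁
    have c2 := NonFano.continuous_s₂
    refine Continuous.div (by fun_prop) (by fun_prop) fun s => ?_
    obtain ⟨h1, h2, h3, h4, -, -⟩ := s.ne
    have h7 := s.ne'
    simp [h1, h2, h3, h4, h7]

/-- `(1 - s₂) / (s₂ (s₁ - 1))` -/
def f₇ : C(NonFano, Line) where
  toFun s := ⟨(1 - s.1.2) / (s.1.2 * (s.1.1 - 1)), by
    obtain ⟨h1, h2, h3, h4, h5, h6⟩ := s.ne
    have h7 := s.ne'
    exact ⟨by simp [h1, h2, h3, h4, h7], by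
        rw [Ne, div_eq_one_iff_eq (by simp [h1, h2, h3, h4, h7])]
        intro h
        exact h6 (by linear_combination h)⟩⟩
  continuous_toFun := by
    refine Continuous.subtype_mk ?_ _
    have c1 := NonFano.continuous_s₁
    have c2 := NonFano.continuous_s₂
    refine Continuous.div (by fun_prop) (by fun_prop) fun s => ?_
    obtain ⟨h1, h2, h3, h4, -, -⟩ := s.ne
    have h7 := s.ne'
    simp [h1, h2, h3, h4, h7]

/-- `s₁` -/
def f₈ : C(NonFano, Line) where
  toFun s := ⟨s.1.1, by
    obtain ⟨h1, h2, h3, h4, h5, h6⟩ := s.ne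
    have h7 := s.ne'
    exact ⟨by simp [h1, h2, h3, h4, h7], fun h => h3 (by rw [h, sub_self])⟩⟩
  continuous_toFun := by
    refine Continuous.subtype_mk ?_ _
    exact NonFano.continuous_s₁

/-- `s₂` -/
def f₉ : C(NonFano, Line) where
  toFun s := ⟨s.1.2, by
    obtain ⟨h1, h2, h3, h4, h5, h6⟩ := s.ne
    have h7 := s.ne'
    exact ⟨by simp [h1, h2, h3, h4, h7], fun h => h4 (by rw [h, sub_self])⟩⟩
  continuous_toFun := by
    refine Continuous.subtype_mk ?_ _
    exact NonFano.continuous_s₂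

/-! ### The images of the tangential base point `v` -/

theorem f₁_baseV (t : UnitOpen) : (f₁ (baseV t) : ℂ) = (((t : ℝ) / (1 + (t : ℝ)) ^ 2 : ℝ) : ℂ) := by
  obtain ⟨t, h0, h1⟩ := t
  have h2 : 1 - t ≠ 0 := by linarith
  have h3 : 1 - t ^ 2 ≠ 0 := by nlinarith
  have h4 : t ^ 2 - 1 ≠ 0 := by nlinarith
  have h5 : 1 + t ≠ 0 := by linarith
  have e : (t ^ 2) * (1 - t) ^ 2 / (t * (1 - (t ^ 2)) ^ 2) = t / (1 + t) ^ 2 := by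
    field_simp
    try ring
  refine Eq.trans ?_ (congrArg Complex.ofReal e)
  try push_cast
  rfl

theorem f₁_bound (t : UnitOpen) : ((f₁.comp baseV) t : ℂ).im = 0 ∧
    0 < ((f₁.comp baseV) t : ℂ).re ∧ ((f₁.comp baseV) t : ℂ).re < 1 := by
  rw [ContinuousMap.comp_apply, f₁_baseV t, Complex.ofReal_im, Complex.ofReal_re]
  obtain ⟨t, h0, h1⟩ := t
  refine ⟨rfl, by positivity, ?_⟩
  rw [div_lt_one (by positivity)]
  nlinarith

theorem f₂_baseV (t : UnitOpen) : (f₂ (baseV t) : ℂ) = (((t : ℝ) ^ 3 : ℝ) : ℂ) := by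
  obtain ⟨t, h0, h1⟩ := t
  have h2 : 1 - t ≠ 0 := by linarith
  have h3 : 1 - t ^ 2 ≠ 0 := by nlinarith
  have h4 : t ^ 2 - 1 ≠ 0 := by nlinarith
  have h5 : 1 + t ≠ 0 := by linarith
  have e : (t ^ 2) * t = t ^ 3 := by
    field_simp
    try ring
  refine Eq.trans ?_ (congrArg Complex.ofReal e)
  try push_cast
  rfl

theorem f₂_bound (t : UnitOpen) : ((f₂.comp baseV) t : ℂ).im = 0 ∧
    0 < ((f₂.comp baseV) t : ℂ).re ∧ ((f₂.comp baseV) t : ℂ).re < 1 := by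
  rw [ContinuousMap.comp_apply, f₂_baseV t, Complex.ofReal_im, Complex.ofReal_re]
  obtain ⟨t, h0, h1⟩ := t
  exact ⟨rfl, by positivity, pow_lt_one₀ h0.le h1 (by norm_num)⟩

theorem f₃_baseV (t : UnitOpen) : (f₃ (baseV t) : ℂ) = (((t : ℝ) : ℝ) : ℂ) := by
  obtain ⟨t, h0, h1⟩ := t
  have h2 : 1 - t ≠ 0 := by linarith
  have h3 : 1 - t ^ 2 ≠ 0 := by nlinarith
  have h4 : t ^ 2 - 1 ≠ 0 := by nlinarith
  have h5 : 1 + t ≠ 0 := by linarith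
  have e : (t ^ 2) / t = t := by
    field_simp
    try ring
  refine Eq.trans ?_ (congrArg Complex.ofReal e)
  try push_cast
  rfl

theorem f₃_bound (t : UnitOpen) : ((f₃.comp baseV) t : ℂ).im = 0 ∧
    0 < ((f₃.comp baseV) t : ℂ).re ∧ ((f₃.comp baseV) t : ℂ).re < 1 := by
  rw [ContinuousMap.comp_apply, f₃_baseV t, Complex.ofReal_im, Complex.ofReal_re]
  obtain ⟨t, h0, h1⟩ := t
  exact ⟨rfl, h0, h1⟩

theorem f₄_baseV (t : UnitOpen) : (f₄ (baseV t) : ℂ) = (((t : ℝ) / (1 + (t : ℝ)) : ℝ) : ℂ) := by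
  obtain ⟨t, h0, h1⟩ := t
  have h2 : 1 - t ≠ 0 := by linarith
  have h3 : 1 - t ^ 2 ≠ 0 := by nlinarith
  have h4 : t ^ 2 - 1 ≠ 0 := by nlinarith
  have h5 : 1 + t ≠ 0 := by linarith
  have e : (t ^ 2) * (1 - t) / (t * (1 - (t ^ 2))) = t / (1 + t) := by
    field_simp
    try ring
  refine Eq.trans ?_ (congrArg Complex.ofReal e)
  try push_cast
  rfl

theorem f₄_bound (t : UnitOpen) : ((f₄.comp baseV) t : ℂ).im = 0 ∧
    0 < ((f₄.comp baseV) t : ℂ).re ∧ ((f₄.comp baseV) t : ℂ).re < 1 := by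
  rw [ContinuousMap.comp_apply, f₄_baseV t, Complex.ofReal_im, Complex.ofReal_re]
  obtain ⟨t, h0, h1⟩ := t
  refine ⟨rfl, by positivity, ?_⟩
  rw [div_lt_one (by positivity)]
  nlinarith

theorem f₅_baseV (t : UnitOpen) : (f₅ (baseV t) : ℂ) = ((-((t : ℝ) ^ 2 / (1 + (t : ℝ))) : ℝ) : ℂ) := by
  obtain ⟨t, h0, h1⟩ := t
  have h2 : 1 - t ≠ 0 := by linarith
  have h3 : 1 - t ^ 2 ≠ 0 := by nlinarith
  have h4 : t ^ 2 - 1 ≠ 0 := by nlinarith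
  have h5 : 1 + t ≠ 0 := by linarith
  have e : (t ^ 2) * (1 - t) / ((t ^ 2) - 1) = -(t ^ 2 / (1 + t)) := by
    field_simp
    try ring
  refine Eq.trans ?_ (congrArg Complex.ofReal e)
  try push_cast
  rfl

theorem f₅_bound (t : UnitOpen) : ((f₅.comp baseV) t : ℂ).im = 0 ∧
    ((f₅.comp baseV) t : ℂ).re < 0 := by
  rw [ContinuousMap.comp_apply, f₅_baseV t, Complex.ofReal_im, Complex.ofReal_re]
  obtain ⟨t, h0, h1⟩ := t
  exact ⟨rfl, neg_lt_zero.2 (by positivity)⟩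

theorem f₆_baseV (t : UnitOpen) : (f₆ (baseV t) : ℂ) = ((1 / (1 + (t : ℝ)) : ℝ) : ℂ) := by
  obtain ⟨t, h0, h1⟩ := t
  have h2 : 1 - t ≠ 0 := by linarith
  have h3 : 1 - t ^ 2 ≠ 0 := by nlinarith
  have h4 : t ^ 2 - 1 ≠ 0 := by nlinarith
  have h5 : 1 + t ≠ 0 := by linarith
  have e : (1 - t) / (1 - (t ^ 2)) = 1 / (1 + t) := by
    field_simp
    try ring
  refine Eq.trans ?_ (congrArg Complex.ofReal e)
  try push_cast
  rfl

theorem f₆_bound (t : UnitOpen) : ((f₆.comp baseV) t : ℂ).im = 0 ∧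
    0 < ((f₆.comp baseV) t : ℂ).re ∧ ((f₆.comp baseV) t : ℂ).re < 1 := by
  rw [ContinuousMap.comp_apply, f₆_baseV t, Complex.ofReal_im, Complex.ofReal_re]
  obtain ⟨t, h0, h1⟩ := t
  refine ⟨rfl, by positivity, ?_⟩
  rw [div_lt_one (by positivity)]
  nlinarith

theorem f₇_baseV (t : UnitOpen) : (f₇ (baseV t) : ℂ) = ((-(1 / ((t : ℝ) * (1 + (t : ℝ)))) : ℝ) : ℂ) := by
  obtain ⟨t, h0, h1⟩ := t
  have h2 : 1 - t ≠ 0 := by linarith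
  have h3 : 1 - t ^ 2 ≠ 0 := by nlinarith
  have h4 : t ^ 2 - 1 ≠ 0 := by nlinarith
  have h5 : 1 + t ≠ 0 := by linarith
  have e : (1 - t) / (t * ((t ^ 2) - 1)) = -(1 / (t * (1 + t))) := by
    field_simp
    try ring
  refine Eq.trans ?_ (congrArg Complex.ofReal e)
  try push_cast
  rfl

theorem f₇_bound (t : UnitOpen) : ((f₇.comp baseV) t : ℂ).im = 0 ∧
    ((f₇.comp baseV) t : ℂ).re < 0 := by
  rw [ContinuousMap.comp_apply, f₇_baseV t, Complex.ofReal_im, Complex.ofReal_re]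
  obtain ⟨t, h0, h1⟩ := t
  exact ⟨rfl, neg_lt_zero.2 (by positivity)⟩

theorem f₈_baseV (t : UnitOpen) : (f₈ (baseV t) : ℂ) = (((t : ℝ) ^ 2 : ℝ) : ℂ) := by
  obtain ⟨t, h0, h1⟩ := t
  have h2 : 1 - t ≠ 0 := by linarith
  have h3 : 1 - t ^ 2 ≠ 0 := by nlinarith
  have h4 : t ^ 2 - 1 ≠ 0 := by nlinarith
  have h5 : 1 + t ≠ 0 := by linarith
  have e : (t ^ 2) = t ^ 2 := by
    field_simp
    try ring
  refine Eq.trans ?_ (congrArg Complex.ofReal e)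
  try push_cast
  rfl

theorem f₈_bound (t : UnitOpen) : ((f₈.comp baseV) t : ℂ).im = 0 ∧
    0 < ((f₈.comp baseV) t : ℂ).re ∧ ((f₈.comp baseV) t : ℂ).re < 1 := by
  rw [ContinuousMap.comp_apply, f₈_baseV t, Complex.ofReal_im, Complex.ofReal_re]
  obtain ⟨t, h0, h1⟩ := t
  exact ⟨rfl, by positivity, pow_lt_one₀ h0.le h1 (by norm_num)⟩

theorem f₉_baseV (t : UnitOpen) : (f₉ (baseV t) : ℂ) = (((t : ℝ) : ℝ) : ℂ) := by
  obtain ⟨t, h0, h1⟩ := t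
  have h2 : 1 - t ≠ 0 := by linarith
  have h3 : 1 - t ^ 2 ≠ 0 := by nlinarith
  have h4 : t ^ 2 - 1 ≠ 0 := by nlinarith
  have h5 : 1 + t ≠ 0 := by linarith
  have e : t = t := by
    field_simp
    try ring
  refine Eq.trans ?_ (congrArg Complex.ofReal e)
  try push_cast
  rfl

theorem f₉_bound (t : UnitOpen) : ((f₉.comp baseV) t : ℂ).im = 0 ∧
    0 < ((f₉.comp baseV) t : ℂ).re ∧ ((f₉.comp baseV) t : ℂ).re < 1 := by
  rw [ContinuousMap.comp_apply, f₉_baseV t, Complex.ofReal_im, Complex.ofReal_re]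
  obtain ⟨t, h0, h1⟩ := t
  exact ⟨rfl, h0, h1⟩

/-! ### The path system -/

/-- `δ · f(γ₀)` for `f = f₁`; here `f(t², t) = t / (1 + t)²`, and `δ` is the trivial path. -/
def γ₁ {P : NonFano} (γ₀ : TangentialPath baseV P) : TangentialPath base01 (f₁ P) :=
  (deltaUnit (f₁.comp baseV) f₁_bound).comp (γ₀.map f₁)

/-- `δ · f(γ₀)` for `f = f₂`; here `f(t², t) = t³`, and `δ` is the trivial path. -/
def γ₂ {P : NonFano} (γ₀ : TangentialPath baseV P) : TangentialPath base01 (f₂ P) :=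
  (deltaUnit (f₂.comp baseV) f₂_bound).comp (γ₀.map f₂)

/-- `δ · f(γ₀)` for `f = f₃`; here `f(t², t) = t`, and `δ` is the trivial path. -/
def γ₃ {P : NonFano} (γ₀ : TangentialPath baseV P) : TangentialPath base01 (f₃ P) :=
  (deltaUnit (f₃.comp baseV) f₃_bound).comp (γ₀.map f₃)

/-- `δ · f(γ₀)` for `f = f₄`; here `f(t², t) = t / (1 + t)`, and `δ` is the trivial path. -/
def γ₄ {P : NonFano} (γ₀ : TangentialPath baseV P) : TangentialPath base01 (f₄ P) :=
  (deltaUnit (f₄.comp baseV) f₄_bound).comp (γ₀.map f₄)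

/-- `δ · f(γ₀)` for `f = f₅`; here `f(t², t) = -(t² / (1 + t))`, and `δ` is the half turn around `0` from `01` to `0∞` through the upper half plane. -/
def γ₅ {P : NonFano} (γ₀ : TangentialPath baseV P) : TangentialPath base01 (f₅ P) :=
  (deltaUpper (f₅.comp baseV) f₅_bound).comp (γ₀.map f₅)

/-- `δ · f(γ₀)` for `f = f₆`; here `f(t², t) = 1 / (1 + t)`, and `δ` is the straight path from `01` to `10`. -/
def γ₆ {P : NonFano} (γ₀ : TangentialPath baseV P) : TangentialPath base01 (f₆ P) :=
  (deltaUnit (f₆.comp baseV) f₆_bound).comp (γ₀.map f₆)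

/-- `δ · f(γ₀)` for `f = f₇`; here `f(t², t) = -(1 / (t (1 + t)))`, and `δ` is the path from `01` to `∞0` through the upper half plane. -/
def γ₇ {P : NonFano} (γ₀ : TangentialPath baseV P) : TangentialPath base01 (f₇ P) :=
  (deltaUpper (f₇.comp baseV) f₇_bound).comp (γ₀.map f₇)

/-- `δ · f(γ₀)` for `f = f₈`; here `f(t², t) = t²`, and `δ` is the trivial path. -/
def γ₈ {P : NonFano} (γ₀ : TangentialPath baseV P) : TangentialPath base01 (f₈ P) :=
  (deltaUnit (f₈.comp baseV) f₈_bound).comp (γ₀.map f₈)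

/-- `δ · f(γ₀)` for `f = f₉`; here `f(t², t) = t`, and `δ` is the trivial path. -/
def γ₉ {P : NonFano} (γ₀ : TangentialPath baseV P) : TangentialPath base01 (f₉ P) :=
  (deltaUnit (f₉.comp baseV) f₉_bound).comp (γ₀.map f₉)

end SpenceKummer

end

open Set

noncomputable section

namespace SpenceKummer

/-! ### The differential system of the logarithm and the polylogarithms -/

/-! The functions log, Li₁, Li₂, … form a tower of primitives of dz/z and dz/(1 - z), so their joint
continuations are sections of a covering of ℙ¹ ∖ {0, 1, ∞}: the covering `solBundle`, whose local
sections are the solutions of the differential system. Iterated integration along a piecewise C¹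
path is a lift to this covering (`isLocalLift_integralsAlong`), so `Li` and `log` are values of the
monodromy `transport` and depend on the homotopy class only (`Li_eq_transport`, `log_eq_transport`).
Every later computation uses local lifts and no chosen representative.

The functional equation is then proved by differentiating three times. Write Lᵢ,ₖ for the continued
Liₖ of fᵢ. The functions fᵢ and 1 - fᵢ are, up to sign, products of powers of x, y, 1 - x, 1 - y, y
- x, 1 - xy. The derivative of the weight three combination is X e₀ + Y e₁ + (B - A) e₂, where X, Y,
B - A are the logarithmic derivatives of x, y, (1 - y)/(1 - x) and e₀, e₁, e₂ are the three
combinations of dilogarithms and products of logarithms in `weightTwo`. The derivatives of these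
vanish because of the six linear relations in `weightOne`, which express multiplicative relations
such as 1 - f₁ = (1 - f₂)(1 - f₃)/(1 - f₈)². The derivatives of the latter vanish identically. So
each layer is constant along connected families once the layer below is zero (`weightOne_constant`,
`weightTwo_constant`, `weightThree_constant`).

It remains to see that the constants are zero, which is done on the curve (t², t). Weight one is
evaluated at t = 3/4, where all nine arguments lie in the open unit disc and have rational values.
For weights two and three one lets t → 0. Eight of the arguments tend to 0 or 1 inside the closed
disc, where the power series is continuous; the value at 1 gives ζ(2) and ζ(3). The seventh, -1/(t(1
+ t)), tends to ∞. There the inversion relations `curveValue_two` and `curveValue_three` are needed;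
their terms in log t and π² are exactly the ones on the right hand side of the theorem, and what is
left tends to 0. Lifting along γ₀ carries the vanishing from the curve to (x, y)
(`weightThree_eq_zero`). -/

/-- The right hand side of the differential system satisfied by `(log, Li₁, Li₂, …)`. -/
def rate (z : ℂ) (v : ℕ → ℂ) : ℕ → ℂ
  | 0 => 1 / z
  | 1 => 1 / (1 - z)
  | (k + 2) => v (k + 1) / z

/-- `G` is a solution on `U` of the differential system of `(log, Li₁, Li₂, …)`. -/
def IsSolOn (U : Set ℂ) (G : ℂ → ℕ → ℂ) : Prop :=
  ∀ z ∈ U, ∀ k, HasDerivAt (fun w => G w k) (rate z (G z) k) z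

theorem IsSolOn.mono {U V : Set ℂ} {G : ℂ → ℕ → ℂ} (h : IsSolOn V G) (hUV : U ⊆ V) :
    IsSolOn U G := fun z hz => h z (hUV hz)

/-- The system is triangular: the rates of log and Li₁ do not involve the solution, and the rate of
each further entry involves only the previous one. So two solutions can be compared one entry at a
time. -/
theorem IsSolOn.eqOn {U : Set ℂ} (hU : IsOpen U) (hU' : IsPreconnected U) {G H : ℂ → ℕ → ℂ}
    (hG : IsSolOn U G) (hH : IsSolOn U H) {x : ℂ} (hx : x ∈ U) (h : G x = H x) :
    EqOn G H U := by
  suffices ∀ k, ∀ z ∈ U, G z k = H z k from fun z hz => funext fun k => this k z hz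
  have step : ∀ k, (∀ z ∈ U, rate z (G z) k = rate z (H z) k) → ∀ z ∈ U, G z k = H z k := by
    intro k hk
    refine hU.eqOn_of_deriv_eq hU' (fun z hz => (hG z hz k).differentiableAt.differentiableWithinAt)
      (fun z hz => (hH z hz k).differentiableAt.differentiableWithinAt) (fun z hz => ?_) hx
      (congrFun h k)
    rw [(hG z hz k).deriv, (hH z hz k).deriv, hk z hz]
  have h1 : ∀ k, ∀ z ∈ U, G z (k + 1) = H z (k + 1) := by
    intro k
    induction k with
    | zero => exact step 1 fun z _ => rfl
    | succ k ih => exact step (k + 2) fun z hz => by simp only [rate, ih z hz]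
  intro k
  cases k with
  | zero => exact step 0 fun z _ => rfl
  | succ k => exact h1 k

/-- Holomorphic functions on a disc have primitives, and each entry is a primitive built from the
one before. The point `x` need not lie in the disc, since a constant can be added to fix the value
anywhere; this makes `sol` total. -/
theorem exists_isSolOn_ball {c : ℂ} {r : ℝ} (h0 : (0 : ℂ) ∉ Metric.ball c r)
    (h1 : (1 : ℂ) ∉ Metric.ball c r) (x : ℂ) (v : ℕ → ℂ) :
    ∃ G, IsSolOn (Metric.ball c r) G ∧ G x = v := by
  -- The holomorphy assumption stands behind the existential quantifier so that `choose` gives an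
  -- operator on all functions, which can be iterated before the iterates are known to be
  -- holomorphic.
  have hP : ∀ (f : ℂ → ℂ) (y : ℂ), ∃ g : ℂ → ℂ, DifferentiableOn ℂ f (Metric.ball c r) →
      g x = y ∧ ∀ z ∈ Metric.ball c r, HasDerivAt g (f z) z := by
    intro f y
    by_cases hf : DifferentiableOn ℂ f (Metric.ball c r)
    · obtain ⟨g, hg⟩ := hf.isExactOn_ball.with_val_at x y
      exact ⟨g, fun _ => ⟨hg.1, fun z hz => hg.2 z hz⟩⟩
    · exact ⟨0, fun h => (hf h).elim⟩
  choose P hP using hP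
  -- The index is shifted: `H k` is entry `k + 1` of the solution, since the logarithm is not part
  -- of the chain.
  let H : ℕ → ℂ → ℂ := fun k => Nat.rec (P (fun z => 1 / (1 - z)) (v 1))
    (fun k g => P (fun z => g z / z) (v (k + 2))) k
  have ne0 : ∀ z ∈ Metric.ball c r, z ≠ 0 := fun z hz h => h0 (h ▸ hz)
  have ne1 : ∀ z ∈ Metric.ball c r, 1 - z ≠ 0 := fun z hz h => h1 (by
    rwa [sub_eq_zero.1 h])
  have hH0 := hP (fun z => 1 / (1 - z)) (v 1) (by
    intro z hz
    exact ((differentiableAt_const _).div ((differentiableAt_const _).sub differentiableAt_id)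
      (ne1 z hz)).differentiableWithinAt)
  have hHd : ∀ k, DifferentiableOn ℂ (H k) (Metric.ball c r) := by
    intro k
    induction k with
    | zero => exact fun z hz => (hH0.2 z hz).differentiableAt.differentiableWithinAt
    | succ k ih =>
      have := hP (fun z => H k z / z) (v (k + 2)) (ih.div differentiableOn_id ne0)
      exact fun z hz => (this.2 z hz).differentiableAt.differentiableWithinAt
  have hHs : ∀ k, _ := fun k => hP (fun z => H k z / z) (v (k + 2))
    ((hHd k).div differentiableOn_id ne0)
  have hl := hP (fun z => 1 / z) (v 0) ((differentiableOn_const _).div differentiableOn_id ne0)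
  refine ⟨fun z k => Nat.casesOn k (P (fun z => 1 / z) (v 0) z) (fun k => H k z), ?_, ?_⟩
  · intro z hz k
    match k with
    | 0 => exact hl.2 z hz
    | 1 => exact hH0.2 z hz
    | k + 2 => exact (hHs k).2 z hz
  · funext k
    match k with
    | 0 => exact hl.1
    | 1 => exact hH0.1
    | k + 2 => exact (hHs k).1

/-! ### The covering space of values of solutions -/

/-- The largest open disc around a point of `ℙ¹ ∖ {0, 1, ∞}` which avoids `0` and `1`. -/
def disc (i : Line) : Set ℂ := Metric.ball (i : ℂ) (min ‖(i : ℂ)‖ ‖(i : ℂ) - 1‖)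

theorem mem_disc_self (i : Line) : (i : ℂ) ∈ disc i :=
  Metric.mem_ball_self (lt_min (norm_pos_iff.2 i.2.1) (norm_pos_iff.2 (sub_ne_zero.2 i.2.2)))

theorem isOpen_disc (i : Line) : IsOpen (disc i) := Metric.isOpen_ball

theorem convex_disc (i : Line) : Convex ℝ (disc i) := convex_ball _ _

theorem exists_isSolOn_disc (i : Line) (x : ℂ) (v : ℕ → ℂ) :
    ∃ G, IsSolOn (disc i) G ∧ G x = v := by
  refine exists_isSolOn_ball ?_ ?_ x v
  · rw [Metric.mem_ball, dist_zero_left, not_lt]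
    exact min_le_left _ _
  · rw [Metric.mem_ball, dist_comm, Complex.dist_eq, not_lt]
    exact min_le_right _ _

/-- The solution on `disc i` with value `v` at `x`. -/
def sol (i : Line) (x : ℂ) (v : ℕ → ℂ) : ℂ → ℕ → ℂ := (exists_isSolOn_disc i x v).choose

theorem sol_isSolOn (i : Line) (x : ℂ) (v : ℕ → ℂ) : IsSolOn (disc i) (sol i x v) :=
  (exists_isSolOn_disc i x v).choose_spec.1

theorem sol_self (i : Line) (x : ℂ) (v : ℕ → ℂ) : sol i x v x = v :=
  (exists_isSolOn_disc i x v).choose_spec.2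

theorem sol_eqOn {i : Line} {x y : ℂ} (hx : x ∈ disc i) {v w : ℕ → ℂ}
    (h : sol i y w x = v) : EqOn (sol i x v) (sol i y w) (disc i) :=
  (sol_isSolOn i x v).eqOn (isOpen_disc i) (convex_disc i).isPreconnected (sol_isSolOn i y w) hx
    ((sol_self i x v).trans h.symm)

/-- Values of solutions, with the discrete topology. -/
@[ext]
structure Value where
  /-- the underlying sequence of numbers -/
  val : ℕ → ℂ

instance : TopologicalSpace Value := ⊥

instance : DiscreteTopology Value := ⟨rfl⟩

/-- The covering of `ℙ¹ ∖ {0, 1, ∞}` whose local sections are the solutions. -/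
def solBundle : FiberBundleCore Line Line Value where
  baseSet i := {z : Line | (z : ℂ) ∈ disc i}
  isOpen_baseSet i := (isOpen_disc i).preimage continuous_subtype_val
  indexAt := fun i => i
  mem_baseSet_at := fun i => mem_disc_self i
  -- The coordinate in chart `i` is the value at the centre of `disc i`: continue from that centre
  -- to `x`, then from `x` to the centre of `disc j`.
  coordChange i j x v := ⟨sol j x (sol i i v.val x) j⟩
  coordChange_self i x hx v := by
    ext1
    change sol i x (sol i i v.val x) i = v.val
    rw [sol_eqOn hx rfl (mem_disc_self i), sol_self]
  continuousOn_coordChange i j := by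
    rintro ⟨x, v⟩ ⟨⟨hxi, hxj⟩, -⟩
    refine ContinuousAt.continuousWithinAt ?_
    refine (continuousAt_const (y := (⟨sol j x (sol i i v.val x) j⟩ : Value))).congr ?_
    have hx : ∀ᶠ y : Line in nhds x, (y : ℂ) ∈ disc i ∩ disc j :=
      (((isOpen_disc i).inter (isOpen_disc j)).preimage continuous_subtype_val).mem_nhds
        ⟨hxi, hxj⟩
    rw [nhds_prod_eq, nhds_discrete Value, Filter.EventuallyEq]
    refine (hx.prod_mk (Filter.eventually_pure.2 (rfl : v = v))).mono ?_
    rintro ⟨y, w⟩ ⟨hy, hw⟩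
    change v = w at hw
    subst hw
    -- The intersection of two discs is convex, hence connected, so a single solution serves for all
    -- nearby base points and the coordinate change is locally constant.
    have e : EqOn (sol j x (sol i i v.val x)) (sol i i v.val) (disc i ∩ disc j) :=
      IsSolOn.eqOn ((isOpen_disc i).inter (isOpen_disc j))
        ((convex_disc i).inter (convex_disc j)).isPreconnected
        ((sol_isSolOn _ _ _).mono inter_subset_right) ((sol_isSolOn _ _ _).mono inter_subset_left)
        ⟨hxi, hxj⟩ (sol_self _ _ _)
    ext1
    exact (sol_eqOn hy.2 (e hy) (mem_disc_self j)).symm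
  coordChange_comp i j k x hx v := by
    ext1
    change sol k x (sol j j (sol j x (sol i i v.val x) j) x) k = sol k x (sol i i v.val x) k
    rw [sol_eqOn (mem_disc_self j) rfl hx.1.2, sol_self]

/-- The total space of the covering `solBundle`. -/
abbrev SolSpace : Type := Bundle.TotalSpace Value solBundle.Fiber

/-- The point of the covering over `x` with value `v`. -/
def SolSpace.mk (x : Line) (v : ℕ → ℂ) : SolSpace := ⟨x, (⟨v⟩ : Value)⟩

/-- The value at a point of the covering. -/
def SolSpace.value (m : SolSpace) : ℕ → ℂ := Value.val m.2

theorem solBundle_isCoveringMap :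
    IsCoveringMap (Bundle.TotalSpace.proj : SolSpace → Line) :=
  FiberBundle.isCoveringMap

/-! ### Lifts of maps and transport along paths -/

/-- Locally, `Φ` is the pullback under `f` of a solution. -/
def IsLocalLift {X : Type*} [TopologicalSpace X] (f : X → Line) (Φ : X → ℕ → ℂ) : Prop :=
  ∀ x, ∃ (U : Set ℂ) (G : ℂ → ℕ → ℂ), IsOpen U ∧ (f x : ℂ) ∈ U ∧ IsSolOn U G ∧
    ∀ᶠ y in nhds x, Φ y = G (f y)

theorem IsSolOn.isLocalLift {X : Type*} [TopologicalSpace X] {f : X → Line} {U : Set ℂ}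
    (hU : IsOpen U) {G : ℂ → ℕ → ℂ} (hG : IsSolOn U G) (hf : ∀ x, (f x : ℂ) ∈ U) :
    IsLocalLift f fun x => G (f x) :=
  fun x => ⟨U, G, hU, hf x, hG, Filter.Eventually.of_forall fun _ => rfl⟩

/-- A point over `x` has its own value as coordinate in the chart centred at `x`; changing to the
chart at `b` continues that value to `b`. -/
theorem trivializationAt_snd (b x : Line) (v : ℕ → ℂ) :
    (trivializationAt Value solBundle.Fiber b (SolSpace.mk x v)).2 = ⟨sol b x v b⟩ := by
  change (⟨sol b x (sol x x v x) b⟩ : Value) = _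
  rw [sol_self]

/-- All nearby values come from one solution, so the coordinate in the chart at `f x` is locally
constant: it is the value of that solution at the centre. -/
theorem IsLocalLift.continuous_mk {X : Type*} [TopologicalSpace X] {f : X → Line}
    (hf : Continuous f) {Φ : X → ℕ → ℂ} (h : IsLocalLift f Φ) :
    Continuous fun x => SolSpace.mk (f x) (Φ x) := by
  refine continuous_iff_continuousAt.2 fun x => ?_
  refine (FiberBundle.continuousAt_totalSpace Value _).2 ⟨hf.continuousAt, ?_⟩
  obtain ⟨U, G, hU, hfU, hG, he⟩ := h x
  obtain ⟨r, hr, hrU⟩ := Metric.isOpen_iff.1 (hU.inter (isOpen_disc (f x))) _ ⟨hfU, mem_disc_self _⟩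
  refine (continuousAt_const (y := (⟨G (f x)⟩ : Value))).congr ?_
  have hfr : ∀ᶠ y in nhds x, (f y : ℂ) ∈ Metric.ball (f x : ℂ) r :=
    (continuous_subtype_val.comp hf).continuousAt.eventually (Metric.ball_mem_nhds _ hr)
  filter_upwards [he, hfr] with y hy hyr
  change _ = (trivializationAt Value solBundle.Fiber (f x) (SolSpace.mk (f y) (Φ y))).2
  rw [trivializationAt_snd, hy]
  have e : EqOn G (sol (f x) (f y) (G (f y))) (Metric.ball (f x : ℂ) r) :=
    IsSolOn.eqOn Metric.isOpen_ball (convex_ball _ _).isPreconnected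
      (hG.mono (hrU.trans inter_subset_left))
      ((sol_isSolOn _ _ _).mono (hrU.trans inter_subset_right)) hyr (sol_self _ _ _).symm
  exact congrArg Value.mk (e (Metric.mem_ball_self hr))

theorem isLocalLift_of_continuous {X : Type*} [TopologicalSpace X]
    {g : X → SolSpace} (hg : Continuous g) :
    IsLocalLift (fun x => (g x).1) (fun x => (g x).value) := by
  intro x
  have hg' := (FiberBundle.continuousAt_totalSpace Value _).1 (hg.continuousAt (x := x))
  set b : Line := (g x).1 with hb
  refine ⟨disc b, sol b b (g x).value, isOpen_disc _, mem_disc_self _, sol_isSolOn _ _ _, ?_⟩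
  have h1 := hg'.2
  -- The fibre is discrete, so a continuous coordinate is locally constant.
  have h2 : ∀ᶠ y in nhds x, (trivializationAt Value solBundle.Fiber b (g y)).2 =
      (trivializationAt Value solBundle.Fiber b (g x)).2 := by
    have := h1.eventually (show {(trivializationAt Value solBundle.Fiber b (g x)).2} ∈ _ from
      (isOpen_discrete _).mem_nhds rfl)
    exact this
  have h3 : ∀ᶠ y in nhds x, ((g y).1 : ℂ) ∈ disc b :=
    hg'.1.eventually (((isOpen_disc b).preimage continuous_subtype_val).mem_nhds (mem_disc_self b))
  filter_upwards [h2, h3] with y hy hy'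
  have e1 : (trivializationAt Value solBundle.Fiber b (g y)).2 = ⟨sol b (g y).1 (g y).value b⟩ :=
    trivializationAt_snd _ _ _
  have e2 : (trivializationAt Value solBundle.Fiber b (g x)).2 = ⟨(g x).value⟩ :=
    (trivializationAt_snd b b (g x).value).trans (congrArg Value.mk (sol_self _ _ _))
  rw [e1, e2] at hy
  have hy2 := sol_eqOn (mem_disc_self b) (congrArg Value.val hy) hy'
  change (g y).value = sol b b (g x).value (g y).1
  rw [hy2]
  exact (sol_self _ _ _).symm

/-- Analytic continuation of a solution along a homotopy class of paths: the value at the end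
of the path in terms of the value at the start. -/
def transport {a b : Line} (q : Path.Homotopic.Quotient a b) (v : ℕ → ℂ) : ℕ → ℂ :=
  SolSpace.value (solBundle_isCoveringMap.monodromy q ⟨SolSpace.mk a v, rfl⟩).1

theorem transport_trans {a b c : Line} (p : Path.Homotopic.Quotient a b)
    (q : Path.Homotopic.Quotient b c) (v : ℕ → ℂ) :
    transport (p.trans q) v = transport q (transport p v) := by
  unfold transport
  rw [IsCoveringMap.monodromy_trans_apply]
  have key : ∀ m : (Bundle.TotalSpace.proj : SolSpace → Line) ⁻¹' {b},
      m = ⟨SolSpace.mk b (SolSpace.value m.1), rfl⟩ := by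
    rintro ⟨⟨b', m⟩, hm⟩
    change b' = b at hm
    subst hm
    rfl
  exact congrArg (fun m => SolSpace.value (solBundle_isCoveringMap.monodromy q m).1) (key _)

/-- A local lift along `p` is a lift of `p` to the covering, and lifts of paths are determined by
their starting points. Transports are evaluated by exhibiting such a lift. -/
theorem transport_mk {a b : Line} (p : Path a b) {Φ : unitInterval → ℕ → ℂ}
    (h : IsLocalLift p Φ) : transport (Path.Homotopic.Quotient.mk p) (Φ 0) = Φ 1 := by
  have hc := h.continuous_mk p.continuous
  have h0 : SolSpace.mk (p 0) (Φ 0) = SolSpace.mk a (Φ 0) := by rw [p.source]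
  have e : (fun s => SolSpace.mk (p s) (Φ s)) =
      solBundle_isCoveringMap.liftPath (p : C(unitInterval, Line))
        (SolSpace.mk a (Φ 0)) p.source :=
    (IsCoveringMap.eq_liftPath_iff (γ := (p : C(unitInterval, Line))) solBundle_isCoveringMap
      p.source).2 ⟨hc, rfl, h0⟩
  exact (congrArg SolSpace.value (congrFun e 1)).symm

theorem exists_isLocalLift {a b : Line} (p : Path a b) (v : ℕ → ℂ) :
    ∃ Φ : unitInterval → ℕ → ℂ, IsLocalLift p Φ ∧ Φ 0 = v := by
  let g := solBundle_isCoveringMap.liftPath (p : C(unitInterval, Line)) (SolSpace.mk a v) p.source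
  have h1 : ∀ s, (g s).1 = p s := fun s => congrFun (solBundle_isCoveringMap.liftPath_lifts
    (p : C(unitInterval, Line)) (SolSpace.mk a v) p.source) s
  have h0 : g 0 = SolSpace.mk a v :=
    solBundle_isCoveringMap.liftPath_zero (p : C(unitInterval, Line)) (SolSpace.mk a v) p.source
  refine ⟨fun s => SolSpace.value (g s), ?_, ?_⟩
  · have := isLocalLift_of_continuous g.continuous
    rwa [show (fun s => (g s).1) = p from funext h1] at this
  · exact congrArg SolSpace.value h0

section Integration

open MeasureTheory intervalIntegral

/-! ### Iterated integrals along piecewise `C¹` paths are lifts -/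

theorem continuous_curve {a b : Line} (p : Path a b) : Continuous (curve p) :=
  continuous_subtype_val.comp p.continuous_extend

theorem curve_ne_zero {a b : Line} (p : Path a b) (t : ℝ) : curve p t ≠ 0 := (p.extend t).2.1

theorem one_sub_curve_ne_zero {a b : Line} (p : Path a b) (t : ℝ) : 1 - curve p t ≠ 0 :=
  sub_ne_zero.2 (p.extend t).2.2.symm

theorem IsPiecewiseC1.intervalIntegrable_deriv {a b : Line} {p : Path a b}
    (hp : IsPiecewiseC1 p) : IntervalIntegrable (deriv (curve p)) volume 0 1 := by
  obtain ⟨S, M, h⟩ := hp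
  rw [intervalIntegrable_iff_integrableOn_Ioo_of_le zero_le_one]
  refine Measure.integrableOn_of_bounded (M := M) (by simp)
    (measurable_deriv _).aestronglyMeasurable ?_
  have h1 : ∀ᵐ t : ℝ ∂volume, t ∉ (S : Set ℝ) :=
    measure_eq_zero_iff_ae_notMem.1 (S.countable_toSet.measure_zero volume)
  rw [ae_restrict_iff' measurableSet_Ioo]
  filter_upwards [h1] with t ht ht'
  exact (h t ht' ht).2

/-- The values of the iterated integrals along the path which follows `(0, ε]` and then `p` up to
`p s`. -/
def integralsAlong {ε : UnitOpen} {z : Line} (p : Path (base01 ε) z) (s : ℝ) : ℕ → ℂ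
  | 0 => ((∫ u in (1 : ℝ)..(ε : ℝ), 1 / u : ℝ) : ℂ) +
      ∫ u in (0 : ℝ)..s, deriv (curve p) u / curve p u
  | (k + 1) => polylogAlong p (k + 1) s

/-- The values of the iterated integrals along `(0, ε]`. -/
def integralsStart (ε : UnitOpen) : ℕ → ℂ
  | 0 => ((∫ u in (1 : ℝ)..(ε : ℝ), 1 / u : ℝ) : ℂ)
  | (k + 1) => polylogStart (k + 1) ε

theorem integralsAlong_eq {ε : UnitOpen} {z : Line} (p : Path (base01 ε) z) (s : ℝ) (k : ℕ) :
    integralsAlong p s k = integralsStart ε k +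
      ∫ u in (0 : ℝ)..s, rate (curve p u) (integralsAlong p u) k * deriv (curve p) u := by
  match k with
  | 0 =>
    simp only [integralsAlong, integralsStart, rate]
    congr 2 with u
    ring
  | 1 =>
    simp only [integralsAlong, integralsStart, rate, polylogAlong]
    congr 2 with u
    ring
  | k + 2 =>
    simp only [integralsAlong, integralsStart, rate]
    rw [polylogAlong]
    refine congrArg _ (integral_congr fun u _ => ?_)
    ring

theorem continuousOn_rate {X : Type*} [TopologicalSpace X] {S : Set X} {c : X → ℂ}
    (hc : ContinuousOn c S) (h0 : ∀ u ∈ S, c u ≠ 0) (h1 : ∀ u ∈ S, 1 - c u ≠ 0) {v : X → ℕ → ℂ}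
    (k : ℕ) (hv : ContinuousOn (fun u => v u (k - 1)) S) :
    ContinuousOn (fun u => rate (c u) (v u) k) S := by
  match k with
  | 0 => exact continuousOn_const.div hc h0
  | 1 => exact continuousOn_const.div (continuousOn_const.sub hc) h1
  | k + 2 => exact hv.div hc h0

theorem integralsAlong_aux {ε : UnitOpen} {z : Line} {p : Path (base01 ε) z}
    (hp : IsPiecewiseC1 p) (k : ℕ) :
    IntervalIntegrable (fun u => rate (curve p u) (integralsAlong p u) k * deriv (curve p) u)
      volume 0 1 ∧ ContinuousOn (fun u => integralsAlong p u k) (Icc 0 1) := by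
  have hc := (continuous_curve p).continuousOn (s := Icc 0 1)
  have hI : ∀ k, ContinuousOn (fun u => rate (curve p u) (integralsAlong p u) k) (Icc 0 1) →
      IntervalIntegrable (fun u => rate (curve p u) (integralsAlong p u) k * deriv (curve p) u)
      volume 0 1 ∧ ContinuousOn (fun u => integralsAlong p u k) (Icc 0 1) := by
    intro k hk
    have h1 : IntervalIntegrable (fun u => rate (curve p u) (integralsAlong p u) k *
        deriv (curve p) u) volume 0 1 :=
      hp.intervalIntegrable_deriv.continuousOn_mul (by rwa [uIcc_of_le zero_le_one])
    refine ⟨h1, ?_⟩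
    simp only [integralsAlong_eq p _ k]
    refine continuousOn_const.add ?_
    have := continuousOn_primitive_interval' h1 (left_mem_uIcc)
    rwa [uIcc_of_le zero_le_one] at this
  have h0 : ∀ u ∈ Icc (0 : ℝ) 1, curve p u ≠ 0 := fun u _ => curve_ne_zero p u
  have h1 : ∀ u ∈ Icc (0 : ℝ) 1, 1 - curve p u ≠ 0 := fun u _ => one_sub_curve_ne_zero p u
  have A : ∀ k, ContinuousOn (fun u => integralsAlong p u (k + 1)) (Icc 0 1) := by
    intro k
    induction k with
    | zero => exact (hI 1 (continuousOn_const.div (continuousOn_const.sub hc) h1)).2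
    | succ k ih => exact (hI (k + 2) (continuousOn_rate hc h0 h1 _ ih)).2
  match k with
  | 0 => exact hI 0 (continuousOn_const.div hc h0)
  | 1 => exact hI 1 (continuousOn_const.div (continuousOn_const.sub hc) h1)
  | k + 2 => exact hI (k + 2) (continuousOn_rate hc h0 h1 _ (A k))

theorem IsPiecewiseC1.hasDerivAt {a b : Line} {p : Path a b} (hp : IsPiecewiseC1 p) :
    ∃ S : Finset ℝ, ∀ t ∈ Ioo (0 : ℝ) 1, t ∉ S →
      HasDerivAt (curve p) (deriv (curve p) t) t := by
  obtain ⟨S, M, h⟩ := hp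
  exact ⟨S, fun t ht hS => ((h t ht hS).1.differentiableAt one_ne_zero).hasDerivAt⟩

/-- Near `s₀` the iterated integrals and the solution through their value at `s₀` satisfy the same
integral equation along the path; the fundamental theorem of calculus, applied off the finite
exceptional set, identifies them entry by entry. -/
theorem isLocalLift_integralsAlong {ε : UnitOpen} {z : Line} {p : Path (base01 ε) z}
    (hp : IsPiecewiseC1 p) :
    IsLocalLift p fun s : unitInterval => integralsAlong p s := by
  intro s₀
  obtain ⟨S, hS⟩ := hp.hasDerivAt
  set G := sol (p s₀) (p s₀) (integralsAlong p s₀)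
  have hG : IsSolOn (disc (p s₀)) G := sol_isSolOn _ _ _
  have hG0 : G (p s₀) = integralsAlong p s₀ := sol_self _ _ _
  have hcp : ∀ s : unitInterval, curve p s = p s := fun s => by simp [curve]
  refine ⟨disc (p s₀), G, isOpen_disc _, mem_disc_self _, hG, ?_⟩
  obtain ⟨δ, hδ, hball⟩ := Metric.isOpen_iff.1
    ((isOpen_disc (p s₀)).preimage (continuous_curve p)) (s₀ : ℝ)
    (by rw [mem_preimage, hcp]; exact mem_disc_self _)
  have hsub : ∀ s : unitInterval, dist (s : ℝ) s₀ < δ →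
      uIcc (s₀ : ℝ) s ⊆ Metric.ball (s₀ : ℝ) δ ∩ Icc 0 1 := by
    intro s hs u hu
    refine ⟨?_, ?_⟩
    · rw [Metric.mem_ball, Real.dist_eq]
      rw [Real.dist_eq] at hs
      have := abs_sub_left_of_mem_uIcc hu
      linarith
    · have : uIcc (s₀ : ℝ) s ⊆ Icc 0 1 := by
        rw [← uIcc_of_le (zero_le_one (α := ℝ))]
        exact uIcc_subset_uIcc (by rw [uIcc_of_le zero_le_one]; exact s₀.2)
          (by rw [uIcc_of_le zero_le_one]; exact s.2)
      exact this hu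
  -- Equality of the rates for entry `k` gives equality of that entry; triangularity of the system
  -- then allows induction.
  have step : ∀ k, (∀ s : unitInterval, dist (s : ℝ) s₀ < δ →
      rate (curve p s) (integralsAlong p s) k = rate (curve p s) (G (curve p s)) k) →
      ∀ s : unitInterval, dist (s : ℝ) s₀ < δ → integralsAlong p s k = G (p s) k := by
    intro k hk s hs
    have hi := (integralsAlong_aux hp k).1
    have hi1 : IntervalIntegrable (fun u => rate (curve p u) (integralsAlong p u) k *
        deriv (curve p) u) volume s₀ s :=
      hi.mono_set ((hsub s hs).trans (by rw [uIcc_of_le zero_le_one]; exact inter_subset_right))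
    have hi0 : IntervalIntegrable (fun u => rate (curve p u) (integralsAlong p u) k *
        deriv (curve p) u) volume 0 s₀ :=
      hi.mono_set (uIcc_subset_uIcc left_mem_uIcc (by rw [uIcc_of_le zero_le_one]; exact s₀.2))
    have e1 : integralsAlong p s k - integralsAlong p s₀ k =
        ∫ u in (s₀ : ℝ)..s, rate (curve p u) (integralsAlong p u) k * deriv (curve p) u := by
      rw [integralsAlong_eq p s k, integralsAlong_eq p s₀ k,
        ← integral_add_adjacent_intervals hi0 hi1]
      ring
    have e2 : ∫ u in (s₀ : ℝ)..s, rate (curve p u) (integralsAlong p u) k * deriv (curve p) u =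
        G (curve p s) k - G (curve p s₀) k := by
      refine integral_eq_of_hasDerivAt_off_countable (fun u => G (curve p u) k) _
        (s := S) S.countable_toSet ?_ ?_ hi1
      · intro u hu
        have := (hG (curve p u) (hball (hsub s hs hu).1) k).continuousAt
        exact (this.comp (f := curve p) (continuous_curve p).continuousAt).continuousWithinAt
      · rintro u ⟨hu, huS⟩
        have hu' := hsub s hs (Ioo_subset_Icc_self hu)
        have hu0 : u ∈ Ioo (0 : ℝ) 1 :=
          ⟨(le_min s₀.2.1 s.2.1).trans_lt hu.1, hu.2.trans_le (max_le s₀.2.2 s.2.2)⟩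
        have := (hG (curve p u) (hball hu'.1) k).comp_of_eq u (hS u hu0 huS) rfl
        have e := hk ⟨u, hu'.2⟩ hu'.1
        simp only at e
        rw [e]
        exact this
    rw [e2, sub_eq_iff_eq_add, hcp, hcp, hG0] at e1
    rw [e1]
    ring
  have A : ∀ k, ∀ s : unitInterval, dist (s : ℝ) s₀ < δ →
      integralsAlong p s (k + 1) = G (p s) (k + 1) := by
    intro k
    induction k with
    | zero => exact step 1 fun s _ => rfl
    | succ k ih => exact step (k + 2) fun s hs => by simp only [rate, ih s hs, hcp]
  have hd : ∀ᶠ s : unitInterval in nhds s₀, dist (s : ℝ) s₀ < δ := Metric.ball_mem_nhds s₀ hδ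
  filter_upwards [hd] with s hs
  funext k
  match k with
  | 0 => exact step 0 (fun s _ => rfl) s hs
  | k + 1 => exact A k s hs

theorem transport_eq_integralsAlong {ε : UnitOpen} {z : Line} {p : Path (base01 ε) z}
    (hp : IsPiecewiseC1 p) :
    transport (Path.Homotopic.Quotient.mk p) (integralsStart ε) = integralsAlong p 1 := by
  have h := transport_mk p (isLocalLift_integralsAlong hp)
  have e : integralsAlong p ((0 : unitInterval) : ℝ) = integralsStart ε := by
    funext k
    rw [integralsAlong_eq]
    simp
  rw [e] at h
  exact h

/-- This removes the chosen representative: the iterated integrals depend only on the homotopy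
class. -/
theorem transport_cls {z : Line} (γ : TangentialPath base01 z) :
    transport (γ.cls half) (integralsStart half) = integralsAlong (representative γ) 1 := by
  have h : IsPiecewiseC1 (representative γ) ∧
      Path.Homotopic.Quotient.mk (representative γ) = γ.cls half :=
    (exists_isPiecewiseC1 (γ.cls half)).choose_spec
  rw [← transport_eq_integralsAlong h.1]
  exact congrArg (fun q => transport q _) h.2.symm

theorem log_eq_transport {z : Line} (γ : TangentialPath base01 z) :
    log z γ = transport (γ.cls half) (integralsStart half) 0 := by
  rw [transport_cls]; rfl

theorem Li_eq_transport (k : ℕ) {z : Line} (γ : TangentialPath base01 z) :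
    Li (k + 1) z γ = transport (γ.cls half) (integralsStart half) (k + 1) := by
  rw [transport_cls]; rfl

end Integration

/-! ### The polylogarithm series -/

/-- The polylogarithm series `∑ zⁿ / nᵏ` over `n ≥ 1`. -/
def polylogSeries (k : ℕ) (z : ℂ) : ℂ := ∑' n : ℕ, z ^ (n + 1) / ((n : ℂ) + 1) ^ k

theorem norm_natCast_add_one (n : ℕ) : ‖(n : ℂ) + 1‖ = (n : ℝ) + 1 := by
  rw [← Nat.cast_add_one, Complex.norm_natCast, Nat.cast_add_one]

theorem norm_polylog_term_le (k n : ℕ) (z : ℂ) :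
    ‖z ^ n / ((n : ℂ) + 1) ^ k‖ ≤ ‖z‖ ^ n := by
  rw [norm_div, norm_pow, norm_pow, norm_natCast_add_one]
  exact div_le_self (by positivity) (one_le_pow₀ (by linarith [n.cast_nonneg (α := ℝ)]))

theorem summable_polylogSeries (k : ℕ) {z : ℂ} (hz : ‖z‖ < 1) :
    Summable fun n : ℕ => z ^ (n + 1) / ((n : ℂ) + 1) ^ k := by
  have : Summable fun n : ℕ => z ^ n / ((n : ℂ) + 1) ^ k :=
    Summable.of_norm_bounded (summable_geometric_of_lt_one (norm_nonneg z) hz)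
      fun n => norm_polylog_term_le k n z
  refine (this.mul_left z).congr fun n => ?_
  ring

theorem polylogSeries_zero_right (k : ℕ) : polylogSeries k 0 = 0 := by
  simp [polylogSeries]

/-- The derivative is left as a series, without division by `z`, so that the origin is included;
this gives continuity at the lower limit of the iterated integrals. -/
theorem hasDerivAt_polylogSeries_aux (k : ℕ) {z : ℂ} (hz : ‖z‖ < 1) :
    HasDerivAt (polylogSeries (k + 1)) (∑' n : ℕ, z ^ n / ((n : ℂ) + 1) ^ k) z := by
  obtain ⟨r, hr, hr1⟩ := exists_between hz
  have hr0 : 0 ≤ r := (norm_nonneg z).trans hr.le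
  refine hasDerivAt_tsum_of_isPreconnected (t := Metric.ball (0 : ℂ) r) (y₀ := z)
    (u := fun n : ℕ => r ^ n) (g := fun (n : ℕ) (z : ℂ) => z ^ (n + 1) / ((n : ℂ) + 1) ^ (k + 1))
    (g' := fun (n : ℕ) (z : ℂ) => z ^ n / ((n : ℂ) + 1) ^ k)
    (summable_geometric_of_lt_one hr0 hr1) Metric.isOpen_ball (convex_ball _ _).isPreconnected
    (fun n y _ => ?_) (fun n y hy => ?_) (by simpa using hr)
    (summable_polylogSeries (k + 1) hz) (by simpa using hr)
  · have hn : (n : ℂ) + 1 ≠ 0 := Nat.cast_add_one_ne_zero n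
    have := (hasDerivAt_pow (n + 1) y).div_const (((n : ℂ) + 1) ^ (k + 1))
    refine this.congr_deriv ?_
    push_cast
    field_simp
    ring
  · have hy' : ‖y‖ < r := by simpa using hy
    exact (norm_polylog_term_le k n y).trans (pow_le_pow_left₀ (norm_nonneg y) hy'.le n)

theorem tsum_eq_polylogSeries_div (k : ℕ) {z : ℂ} (hz0 : z ≠ 0) :
    ∑' n : ℕ, z ^ n / ((n : ℂ) + 1) ^ k = polylogSeries k z / z := by
  rw [polylogSeries, ← tsum_div_const]
  refine tsum_congr fun n => ?_
  rw [pow_succ]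
  field_simp

theorem hasDerivAt_polylogSeries (k : ℕ) {z : ℂ} (hz : ‖z‖ < 1) (hz0 : z ≠ 0) :
    HasDerivAt (polylogSeries (k + 1)) (polylogSeries k z / z) z := by
  rw [← tsum_eq_polylogSeries_div k hz0]
  exact hasDerivAt_polylogSeries_aux k hz

theorem polylogSeries_one {z : ℂ} (hz : ‖z‖ < 1) :
    polylogSeries 1 z = -Complex.log (1 - z) := by
  have h := (hasSum_nat_add_iff' 1).2 (Complex.hasSum_taylorSeries_neg_log hz)
  simp only [Finset.range_one, Finset.sum_singleton, Nat.cast_zero, div_zero, sub_zero] at h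
  rw [← h.tsum_eq, polylogSeries]
  refine tsum_congr fun n => ?_
  push_cast
  rw [pow_one]

theorem hasDerivAt_polylogSeries_one {z : ℂ} (hz : ‖z‖ < 1) :
    HasDerivAt (polylogSeries 1) (1 / (1 - z)) z := by
  have h := hasDerivAt_polylogSeries_aux 0 hz
  simp only [pow_zero, div_one] at h
  rwa [tsum_geometric_of_norm_lt_one hz, ← one_div] at h

theorem summable_one_div_pow (k : ℕ) :
    Summable fun n : ℕ => 1 / ((n : ℝ) + 1) ^ (k + 2) := by
  have := (summable_nat_add_iff 1).2 (Real.summable_one_div_nat_pow.2 (by omega : 1 < k + 2))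
  exact_mod_cast this

/-- From weight two on, convergence is uniform up to the unit circle. This allows the limits at the
boundary points 1 and -1. -/
theorem continuousOn_polylogSeries (k : ℕ) :
    ContinuousOn (polylogSeries (k + 2)) (Metric.closedBall 0 1) := by
  refine continuousOn_tsum (fun n => by fun_prop) (summable_one_div_pow k) fun n z hz => ?_
  have hz' : ‖z‖ ≤ 1 := by simpa using hz
  rw [norm_div, norm_pow, norm_pow, norm_natCast_add_one]
  gcongr
  exact pow_le_one₀ (norm_nonneg z) hz'

theorem polylogSeries_apply_one (k : ℕ) :
    polylogSeries (k + 2) 1 = riemannZeta (k + 2 : ℕ) := by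
  rw [zeta_nat_eq_tsum_of_gt_one (by omega), polylogSeries]
  have hs : Summable fun n : ℕ => 1 / (n : ℂ) ^ (k + 2) := by
    have := Real.summable_one_div_nat_pow.2 (by omega : 1 < k + 2)
    simpa using Complex.summable_ofReal.2 this
  rw [hs.tsum_eq_zero_add]
  simp

theorem polylogSeries_two_one : polylogSeries 2 1 = (Real.pi : ℂ) ^ 2 / 6 := by
  rw [polylogSeries_apply_one 0, ← riemannZeta_two]
  norm_num

theorem polylogSeries_three_one : polylogSeries 3 1 = riemannZeta 3 := by
  rw [polylogSeries_apply_one 1]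
  norm_num

theorem polylogSeries_two_neg_one : polylogSeries 2 (-1) = -((Real.pi : ℂ) ^ 2 / 12) := by
  have hs : Summable fun n : ℕ => 1 / ((n : ℂ) + 1) ^ 2 := by
    simpa using Complex.summable_ofReal.2 (summable_one_div_pow 0)
  have hz : ∑' n : ℕ, 1 / ((n : ℂ) + 1) ^ 2 = (Real.pi : ℂ) ^ 2 / 6 := by
    rw [← polylogSeries_two_one, polylogSeries]
    simp
  have h2 : Function.Injective fun n : ℕ => 2 * n := fun a b h => by simpa using h
  have h3 : Function.Injective fun n : ℕ => 2 * n + 1 := fun a b h => by simpa using h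
  have se := hs.comp_injective h2
  have so := hs.comp_injective h3
  -- Because of the shift by one, odd indices correspond to even denominators, whose share of the
  -- sum is one quarter.
  have hodd : ∑' n : ℕ, 1 / (((2 * n + 1 : ℕ) : ℂ) + 1) ^ 2 =
      1 / 4 * ∑' n : ℕ, 1 / ((n : ℂ) + 1) ^ 2 := by
    rw [← tsum_mul_left]
    refine tsum_congr fun n => ?_
    have hn : (n : ℂ) + 1 ≠ 0 := Nat.cast_add_one_ne_zero n
    push_cast
    rw [show (2 * (n : ℂ) + 1 + 1) = 2 * (n + 1) by ring]
    field_simp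
    norm_num
  have e1 := tsum_even_add_odd (f := fun n : ℕ => 1 / ((n : ℂ) + 1) ^ 2) se so
  have e2 : polylogSeries 2 (-1) = -∑' n : ℕ, 1 / (((2 * n : ℕ) : ℂ) + 1) ^ 2 +
      ∑' n : ℕ, 1 / (((2 * n + 1 : ℕ) : ℂ) + 1) ^ 2 := by
    have a1 : ∀ n : ℕ, -(1 / (((2 * n : ℕ) : ℂ) + 1) ^ 2) =
        (-1 : ℂ) ^ (2 * n + 1) / (((2 * n : ℕ) : ℂ) + 1) ^ 2 := by
      intro n
      rw [Odd.neg_one_pow ⟨n, rfl⟩, neg_div]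
    have a2 : ∀ n : ℕ, 1 / (((2 * n + 1 : ℕ) : ℂ) + 1) ^ 2 =
        (-1 : ℂ) ^ (2 * n + 1 + 1) / (((2 * n + 1 : ℕ) : ℂ) + 1) ^ 2 := by
      intro n
      rw [Even.neg_one_pow ⟨n + 1, by ring⟩]
    rw [← tsum_neg, tsum_congr a1, tsum_congr a2, polylogSeries]
    refine (tsum_even_add_odd (f := fun n : ℕ => (-1 : ℂ) ^ (n + 1) / ((n : ℂ) + 1) ^ 2)
      ?_ ?_).symm
    · exact se.neg.congr a1
    · exact so.congr a2
  rw [hodd] at e1 e2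
  rw [hz] at e1 e2
  linear_combination e2 - e1

/-! ### Initial values -/

theorem polylogSeries_ofReal (k : ℕ) (t : ℝ) :
    polylogSeries k t = ((∑' n : ℕ, t ^ (n + 1) / ((n : ℝ) + 1) ^ k : ℝ) : ℂ) := by
  rw [polylogSeries, Complex.ofReal_tsum]
  push_cast
  rfl

theorem polylogStart_eq (k : ℕ) :
    ∀ t ∈ Ioo (0 : ℝ) 1, polylogStart k t = ∑' n : ℕ, t ^ (n + 1) / ((n : ℝ) + 1) ^ k := by
  have hre : ∀ k (t : ℝ), (polylogSeries k t).re = ∑' n : ℕ, t ^ (n + 1) / ((n : ℝ) + 1) ^ k := by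
    intro k t
    rw [polylogSeries_ofReal, Complex.ofReal_re]
  have hd : ∀ k, ∀ t ∈ Ioo (-1 : ℝ) 1,
      ∃ d, HasDerivAt (fun t : ℝ => (polylogSeries (k + 1) t).re) d t := by
    intro k t ht
    have : ‖(t : ℂ)‖ < 1 := by
      rw [Complex.norm_real, Real.norm_eq_abs, abs_lt]
      exact ht
    exact ⟨_, (hasDerivAt_polylogSeries_aux k this).real_of_complex⟩
  -- The derivative is only known on the open interval, as the integrand contains a division by `u`.
  -- Continuity of the series at 0 and nonnegativity of the integrand replace regularity at the
  -- endpoint.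
  have step : ∀ (k : ℕ) (g : ℝ → ℝ), (∀ u ∈ Ioo (0 : ℝ) 1,
      HasDerivAt (fun t : ℝ => (polylogSeries (k + 1) t).re) (g u) u) →
      (∀ u ∈ Ioo (0 : ℝ) 1, 0 ≤ g u) → ∀ t ∈ Ioo (0 : ℝ) 1,
      ∫ u in (0 : ℝ)..t, g u = ∑' n : ℕ, t ^ (n + 1) / ((n : ℝ) + 1) ^ (k + 1) := by
    intro k g hg hg0 t ht
    have hc : ContinuousOn (fun t : ℝ => (polylogSeries (k + 1) t).re) (Icc 0 t) := fun u hu => by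
      obtain ⟨d, h⟩ := hd k u ⟨by linarith [hu.1], by linarith [hu.2, ht.2]⟩
      exact h.continuousAt.continuousWithinAt
    have hsub : ∀ u ∈ Ioo 0 t, u ∈ Ioo (0 : ℝ) 1 := fun u hu => ⟨hu.1, hu.2.trans ht.2⟩
    rw [intervalIntegral.integral_eq_sub_of_hasDerivAt_of_le ht.1.le hc
      (fun u hu => hg u (hsub u hu))]
    · rw [hre, Complex.ofReal_zero, polylogSeries_zero_right, Complex.zero_re, sub_zero]
    · refine intervalIntegral.intervalIntegrable_deriv_of_nonneg
        (g := fun t : ℝ => (polylogSeries (k + 1) t).re) ?_ ?_ ?_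
      · rwa [uIcc_of_le ht.1.le]
      · rw [min_eq_left ht.1.le, max_eq_right ht.1.le]
        exact fun u hu => hg u (hsub u hu)
      · rw [min_eq_left ht.1.le, max_eq_right ht.1.le]
        exact fun u hu => hg0 u (hsub u hu)
  have hnorm : ∀ u ∈ Ioo (0 : ℝ) 1, ‖(u : ℂ)‖ < 1 ∧ (u : ℂ) ≠ 0 := fun u hu =>
    ⟨by rw [Complex.norm_real, Real.norm_of_nonneg hu.1.le]; exact hu.2,
      Complex.ofReal_ne_zero.2 hu.1.ne'⟩
  have main : ∀ k, ∀ t ∈ Ioo (0 : ℝ) 1,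
      polylogStart (k + 1) t = ∑' n : ℕ, t ^ (n + 1) / ((n : ℝ) + 1) ^ (k + 1) := by
    intro k
    induction k with
    | zero =>
      refine step 0 (fun u => 1 / (1 - u)) (fun u hu => ?_) fun u hu => ?_
      · refine (hasDerivAt_polylogSeries_one (hnorm u hu).1).real_of_complex.congr_deriv ?_
        rw [← Complex.ofReal_one, ← Complex.ofReal_sub, ← Complex.ofReal_div, Complex.ofReal_re]
      · exact div_nonneg zero_le_one (by linarith [hu.2])
    | succ k ih =>
      refine step (k + 1) (fun u => polylogStart (k + 1) u / u) (fun u hu => ?_) fun u hu => ?_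
      · refine (hasDerivAt_polylogSeries (k + 1)
          (hnorm u hu).1 (hnorm u hu).2).real_of_complex.congr_deriv ?_
        rw [polylogSeries_ofReal, ← Complex.ofReal_div, Complex.ofReal_re, ih u hu]
      · rw [ih u hu]
        have := hu.1
        positivity
  intro t ht
  cases k with
  | zero =>
    have h := tsum_geometric_of_lt_one ht.1.le ht.2
    simp only [pow_zero, div_one, pow_succ, tsum_mul_right, h, polylogStart]
    ring
  | succ k => exact main k t ht

/-- The values of the polylogarithms on the unit disc, in the logarithmic coordinate. -/
def principal (w : ℂ) : ℕ → ℂ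
  | 0 => w
  | (k + 1) => polylogSeries (k + 1) (Complex.exp w)

theorem integralsStart_eq (ε : UnitOpen) :
    integralsStart ε = principal ((Real.log ε : ℝ) : ℂ) := by
  funext k
  cases k with
  | zero =>
    rw [integralsStart, principal, integral_one_div_of_pos one_pos ε.2.1, div_one]
  | succ k =>
    rw [integralsStart, principal, ← Complex.ofReal_exp, Real.exp_log ε.2.1, polylogSeries_ofReal,
      polylogStart_eq _ _ ε.2]

/-- On the punctured unit disc the polylogarithm series has no monodromy, so only the logarithm has
to be followed, and `w` does this. -/
theorem isLocalLift_principal {X : Type*} [TopologicalSpace X] {f : X → Line} {w : X → ℂ}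
    (hw : Continuous w) (hre : ∀ x, (w x).re < 0) (hf : ∀ x, (f x : ℂ) = Complex.exp (w x)) :
    IsLocalLift f fun x => principal (w x) := by
  intro x
  -- The branch of the logarithm near `f x` with value `w x` there: the argument of the principal
  -- branch is close to 1.
  let G : ℂ → ℕ → ℂ := fun z k => Nat.casesOn k
    (w x + Complex.log (z * Complex.exp (-w x))) (fun k => polylogSeries (k + 1) z)
  have hUo : IsOpen {z : ℂ | ‖z‖ < 1 ∧ z * Complex.exp (-w x) ∈ Complex.slitPlane} :=
    (isOpen_lt continuous_norm continuous_const).inter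
      (Complex.isOpen_slitPlane.preimage (by fun_prop))
  refine ⟨{z : ℂ | ‖z‖ < 1 ∧ z * Complex.exp (-w x) ∈ Complex.slitPlane}, G, hUo,
    ⟨?_, ?_⟩, ?_, ?_⟩
  · rw [hf, Complex.norm_exp]
    exact Real.exp_lt_one_iff.2 (hre x)
  · rw [hf, ← Complex.exp_add, add_neg_cancel, Complex.exp_zero]
    exact Complex.one_mem_slitPlane
  · rintro z ⟨hz, hz'⟩ k
    have hz0 : z ≠ 0 := fun h => Complex.slitPlane_ne_zero hz' (by rw [h, zero_mul])
    match k with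
    | 0 =>
      have h1 : HasDerivAt (fun z => z * Complex.exp (-w x)) (Complex.exp (-w x)) z := by
        simpa using (hasDerivAt_id z).mul_const (Complex.exp (-w x))
      refine ((h1.clog hz').const_add (w x)).congr_deriv ?_
      have := Complex.exp_ne_zero (-w x)
      simp only [rate]
      field_simp
    | 1 => exact hasDerivAt_polylogSeries_one hz
    | k + 2 => exact hasDerivAt_polylogSeries (k + 1) hz hz0
  · have h1 : ∀ᶠ y in nhds x, |(w y - w x).im| < Real.pi := by
      have : Continuous fun y => |(w y - w x).im| := by fun_prop
      refine this.continuousAt.eventually (gt_mem_nhds ?_)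
      simpa using Real.pi_pos
    filter_upwards [h1] with y hy
    rw [abs_lt] at hy
    funext k
    match k with
    | 0 =>
      change w y = w x + Complex.log (f y * Complex.exp (-w x))
      rw [hf, ← Complex.exp_add, ← sub_eq_add_neg, Complex.log_exp hy.1 hy.2.le]
      ring
    | k + 1 =>
      change _ = polylogSeries (k + 1) (f y)
      rw [hf]
      rfl

/-! ### Continuation from `01` along a tangential base point -/

/-- The values at the point `b t` of the continuation along `δ` of the polylogarithms. -/
def connectionValue {b : C(UnitOpen, Line)} (δ : TangentialConnection base01 b) (t : UnitOpen) :
    ℕ → ℂ :=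
  transport (δ.cls half t) (integralsStart half)

/-- Compatibility of `δ` with moving its end along `b` says that the values at different points of
`b` are transports of one another along `b`. -/
theorem isLocalLift_connectionValue {b : C(UnitOpen, Line)} (δ : TangentialConnection base01 b) :
    IsLocalLift b (connectionValue δ) := by
  intro t
  refine ⟨disc (b t), sol (b t) (b t) (connectionValue δ t), isOpen_disc _, mem_disc_self _,
    sol_isSolOn _ _ _, ?_⟩
  have hU : IsOpen {t' : UnitOpen | (b t' : ℂ) ∈ disc (b t)} :=
    (isOpen_disc (b t)).preimage (continuous_subtype_val.comp b.continuous)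
  obtain ⟨r, hr, hball⟩ := Metric.isOpen_iff.1 hU t (mem_disc_self _)
  filter_upwards [Metric.ball_mem_nhds t hr] with t' ht'
  have hq : ∀ s, segmentPath (convex_Ioo (0 : ℝ) 1) t t' s ∈ Metric.ball t r := by
    intro s
    have h1 : (AffineMap.lineMap (t : ℝ) (t' : ℝ) (s : ℝ) : ℝ) ∈ Metric.ball (t : ℝ) r :=
      (convex_ball (t : ℝ) r).segment_subset (Metric.mem_ball_self hr) ht' (by
        rw [segment_eq_image_lineMap]
        exact ⟨s, s.2, rfl⟩)
    exact h1
  have h := transport_mk ((segmentPath (convex_Ioo (0 : ℝ) 1) t t').map b.continuous)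
    ((sol_isSolOn (b t) (b t) (connectionValue δ t)).isLocalLift (isOpen_disc (b t))
      fun s => hball (hq s))
  rw [Path.source, Path.target, sol_self] at h
  rw [← h]
  unfold connectionValue
  rw [← transport_trans, ← δ.compat_right]

theorem connectionValue_ofConvex {E : Type*} [NormedAddCommGroup E] [NormedSpace ℝ E] {W : Set E}
    (hW : Convex ℝ W) (e : C(W, Line)) (α β : C(UnitOpen, W)) {b : C(UnitOpen, Line)}
    (ha : base01 = e.comp α) (hb : b = e.comp β) (t : UnitOpen) {w : unitInterval → ℂ}
    (hw : Continuous w) (hre : ∀ s, (w s).re < 0)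
    (hf : ∀ s, (e (segmentPath hW (α half) (β t) s) : ℂ) = Complex.exp (w s))
    (h0 : w 0 = ((Real.log half : ℝ) : ℂ)) :
    connectionValue (TangentialConnection.ofConvex hW e α β ha hb) t = principal (w 1) := by
  have h := transport_mk
    (((segmentPath hW (α half) (β t)).map e.continuous).cast
      (show base01 half = e (α half) by rw [ha]; rfl) (show b t = e (β t) by rw [hb]; rfl))
    (isLocalLift_principal hw hre hf)
  simp only [h0, ← integralsStart_eq] at h
  exact h

theorem connectionValue_deltaUnit (b : C(UnitOpen, Line))
    (hb : ∀ t, (b t : ℂ).im = 0 ∧ 0 < (b t : ℂ).re ∧ (b t : ℂ).re < 1) (t : UnitOpen) :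
    connectionValue (deltaUnit b hb) t = principal ((Real.log (b t : ℂ).re : ℝ) : ℂ) := by
  let p : Path half (⟨(b t : ℂ).re, (hb t).2⟩ : UnitOpen) := segmentPath (convex_Ioo (0 : ℝ) 1) _ _
  have h := connectionValue_ofConvex (convex_Ioo (0 : ℝ) 1) base01 (ContinuousMap.id UnitOpen)
    { toFun := fun t => ⟨(b t : ℂ).re, (hb t).2⟩
      continuous_toFun := by
        refine Continuous.subtype_mk ?_ _
        exact Complex.continuous_re.comp (continuous_subtype_val.comp b.continuous) }
    (by ext t; rfl)
    (by
      ext t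
      change (b t : ℂ) = (((b t : ℂ).re : ℝ) : ℂ)
      apply Complex.ext <;> simp [(hb t).1]) t (w := fun s => ((Real.log (p s) : ℝ) : ℂ))
    (Complex.continuous_ofReal.comp
      ((continuous_subtype_val.comp p.continuous).log fun s => (p s).2.1.ne'))
    (fun s => by rw [Complex.ofReal_re]; exact Real.log_neg (p s).2.1 (p s).2.2)
    (fun s => by rw [← Complex.ofReal_exp, Real.exp_log (p s).2.1]; rfl)
    (by rw [p.source])
  rw [p.target] at h
  exact h

/-- The bound `-1 < (b t).re` keeps the whole arc inside the unit disc, where the series represents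
the continuation. -/
theorem connectionValue_deltaUpper (b : C(UnitOpen, Line))
    (hb : ∀ t, (b t : ℂ).im = 0 ∧ (b t : ℂ).re < 0) (t : UnitOpen) (ht : -1 < (b t : ℂ).re) :
    connectionValue (deltaUpper b hb) t =
      principal (((Real.log (-(b t : ℂ).re) : ℝ) : ℂ) + Real.pi * Complex.I) := by
  have hneg : 0 < -(b t : ℂ).re := neg_pos.2 (hb t).2
  let u : strip := ⟨((Real.log half : ℝ) : ℂ), by simp, by simpa using Real.pi_pos.le,
    fun _ => by simpa using Real.log_neg half.2.1 half.2.2⟩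
  let v : strip := ⟨((Real.log (-(b t : ℂ).re) : ℝ) : ℂ) + Real.pi * Complex.I,
        by simpa using Real.pi_pos.le, by simp,
        fun h => by simp at h⟩
  let p : Path u v := segmentPath convex_strip _ _
  have h := connectionValue_ofConvex convex_strip expStrip
    { toFun := fun t => ⟨((Real.log t : ℝ) : ℂ), by simp, by simpa using Real.pi_pos.le,
        fun _ => by simpa using Real.log_neg t.2.1 t.2.2⟩
      continuous_toFun := by
        refine Continuous.subtype_mk ?_ _
        exact Complex.continuous_ofReal.comp
          (continuous_subtype_val.log fun t => t.2.1.ne') }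
    { toFun := fun t => ⟨((Real.log (-(b t : ℂ).re) : ℝ) : ℂ) + Real.pi * Complex.I,
        by simpa using Real.pi_pos.le, by simp,
        fun h => by simp at h⟩
      continuous_toFun := by
        refine Continuous.subtype_mk ?_ _
        refine (Complex.continuous_ofReal.comp (Continuous.log ?_ fun t => ?_)).add
          continuous_const
        · exact (Complex.continuous_re.comp (continuous_subtype_val.comp b.continuous)).neg
        · exact (neg_pos.2 (hb t).2).ne' }
    (by
      ext t
      change ((t : ℝ) : ℂ) = Complex.exp ((Real.log t : ℝ) : ℂ)
      rw [← Complex.ofReal_exp, Real.exp_log t.2.1])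
    (by
      ext t
      change (b t : ℂ) = Complex.exp (((Real.log (-(b t : ℂ).re) : ℝ) : ℂ) + Real.pi * Complex.I)
      rw [Complex.exp_add, Complex.exp_pi_mul_I, ← Complex.ofReal_exp,
        Real.exp_log (neg_pos.2 (hb t).2)]
      apply Complex.ext <;> simp [(hb t).1]) t (w := fun s => (p s : ℂ))
    (continuous_subtype_val.comp p.continuous)
    (fun s => by
      have hc : Convex ℝ {z : ℂ | z.re < 0} := convex_halfSpace_re_lt 0
      have hu : (u : ℂ) ∈ {z : ℂ | z.re < 0} := by
        simpa [u] using Real.log_neg half.2.1 half.2.2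
      have hv : (v : ℂ) ∈ {z : ℂ | z.re < 0} := by
        simpa [v] using Real.log_neg hneg (by linarith)
      exact hc.segment_subset hu hv (by
        rw [segment_eq_image_lineMap]
        exact ⟨s, s.2, rfl⟩))
    (fun s => rfl)
    (by rw [p.source])
  rw [p.target] at h
  exact h

theorem transport_comp {b : C(UnitOpen, Line)} {z : Line} (δ : TangentialConnection base01 b)
    (γ : TangentialPath b z) :
    transport ((δ.comp γ).cls half) (integralsStart half) =
      transport (γ.cls half) (connectionValue δ half) :=
  transport_trans _ _ _

/-! ### Relations between the nine families of polylogarithms -/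

/-- The nine maps. -/
def nine : Fin 9 → C(NonFano, Line) := ![f₁, f₂, f₃, f₄, f₅, f₆, f₇, f₈, f₉]

/-- The formulas of the nine maps. -/
def nineFormula (x y : ℂ) : Fin 9 → ℂ :=
  ![x * (1 - y) ^ 2 / (y * (1 - x) ^ 2), x * y, x / y, x * (1 - y) / (y * (1 - x)),
    x * (1 - y) / (x - 1), (1 - y) / (1 - x), (1 - y) / (y * (x - 1)), x, y]

theorem nine_apply (i : Fin 9) (s : NonFano) : (nine i s : ℂ) = nineFormula s.1.1 s.1.2 i := by
  fin_cases i <;> rfl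

/-- The logarithmic derivatives of the nine maps, in terms of the logarithmic derivatives
`X, Y, A, B` of `x, y, 1 - x, 1 - y`. -/
def dlogNine (X Y A B : ℂ) : Fin 9 → ℂ :=
  ![X + 2 * B - Y - 2 * A, X + Y, X - Y, X + B - Y - A, X + B - A, B - A, B - Y - A, X, Y]

/-- The logarithmic derivatives of `1 - f` for the nine maps `f`, in terms of the logarithmic
derivatives `Y, A, B, C, D` of `y, 1 - x, 1 - y, y - x, 1 - x y`. -/
def dlogOneSubNine (Y A B C D : ℂ) : Fin 9 → ℂ :=
  ![C + D - Y - 2 * A, D, C - Y, C - Y - A, D - A, C - A, D - Y - A, A, B]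

/-- The left hand sides of the linear relations between logarithms. -/
def weightOne (m : Fin 9 → ℕ → ℂ) : Fin 6 → ℂ :=
  ![m 0 1 - m 2 1 - m 1 1 + 2 * m 7 1, m 3 1 - m 2 1 + m 7 1, m 4 1 - m 1 1 + m 7 1,
    m 5 1 + m 8 0 - m 2 1 + m 7 1, m 6 1 - m 1 1 - m 8 0 + m 7 1, m 5 0 + m 8 1 - m 7 1]

/-- The left hand sides of the relations between dilogarithms. -/
def weightTwo (m : Fin 9 → ℕ → ℂ) : Fin 3 → ℂ :=
  ![m 0 2 + m 1 2 + m 2 2 - 2 * m 3 2 - 2 * m 4 2 - 2 * m 7 2,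
    m 1 2 - m 0 2 - m 2 2 + 2 * m 3 2 + 2 * m 6 2 - 2 * m 8 2 - 2 * (m 8 0 * m 5 0) + m 8 0 ^ 2
      + (Real.pi : ℂ) ^ 2 / 3,
    2 * (m 0 2 - m 3 2 - m 4 2 - m 5 2 - m 6 2) - m 8 0 ^ 2]

/-- The difference of the two sides of the relation between trilogarithms. -/
def weightThree (m : Fin 9 → ℕ → ℂ) : ℂ :=
  m 0 3 + m 1 3 + m 2 3 - 2 * m 3 3 - 2 * m 4 3 - 2 * m 5 3 - 2 * m 6 3 - 2 * m 7 3 - 2 * m 8 3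
    - m 8 0 ^ 2 * m 5 0 + (Real.pi : ℂ) ^ 2 / 3 * m 8 0 + 1 / 3 * m 8 0 ^ 3 + 2 * riemannZeta 3

/-- The functions `M` satisfy on `U` the differential equations of the nine families. -/
def IsNineSystem (U : Set ℂ) (M : ℂ → Fin 9 → ℕ → ℂ) : Prop :=
  ∀ s ∈ U, ∃ X Y A B C D : ℂ, ∀ i,
    HasDerivAt (fun s => M s i 0) (dlogNine X Y A B i) s ∧
    HasDerivAt (fun s => M s i 1) (-dlogOneSubNine Y A B C D i) s ∧
    ∀ k, HasDerivAt (fun s => M s i (k + 2)) (M s i (k + 1) * dlogNine X Y A B i) s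

theorem eq_of_hasDerivAt_zero {U : Set ℂ} (hU : IsOpen U) (hU' : IsPreconnected U) {g : ℂ → ℂ}
    (hg : ∀ s ∈ U, HasDerivAt g 0 s) {s t : ℂ} (hs : s ∈ U) (ht : t ∈ U) : g s = g t :=
  hU.is_const_of_deriv_eq_zero hU' (fun s hs => (hg s hs).differentiableAt.differentiableWithinAt)
    (fun s hs => (hg s hs).deriv) hs ht

/-! ### Differentiating the combinations of weight one, two and three -/

section Conservation

variable {U : Set ℂ} {M : ℂ → Fin 9 → ℕ → ℂ}

/-- With f₁, …, f₉ at indices 0, …, 8, these are the logarithms of 1 - f₁ = (1 - f₂)(1 - f₃)/(1 -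
f₈)², 1 - f₄ = (1 - f₃)/(1 - f₈), 1 - f₅ = (1 - f₂)/(1 - f₈), 1 - f₆ = f₉(1 - f₃)/(1 - f₈), 1 - f₇ =
(1 - f₂)/(f₉(1 - f₈)) and f₆ = (1 - f₉)/(1 - f₈). The logarithmic derivatives cancel formally. -/
theorem IsNineSystem.weightOne_eq (hU : IsOpen U) (hU' : IsPreconnected U)
    (hM : IsNineSystem U M) {s t : ℂ} (hs : s ∈ U) (ht : t ∈ U) :
    weightOne (M s) = weightOne (M t) := by
  funext j
  refine eq_of_hasDerivAt_zero hU hU' (g := fun s => weightOne (M s) j) (fun s hs => ?_) hs ht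
  obtain ⟨X, Y, A, B, C, D, h⟩ := hM s hs
  have h0 := fun i => (h i).1
  have h1 := fun i => (h i).2.1
  fin_cases j
  · refine ((((h1 0).fun_sub (h1 2)).fun_sub (h1 1)).fun_add ((h1 7).const_mul 2)).congr_deriv ?_
    simp only [dlogOneSubNine, Matrix.cons_val]; ring
  · refine (((h1 3).fun_sub (h1 2)).fun_add (h1 7)).congr_deriv ?_
    simp only [dlogOneSubNine, Matrix.cons_val]; ring
  · refine (((h1 4).fun_sub (h1 1)).fun_add (h1 7)).congr_deriv ?_
    simp only [dlogOneSubNine, Matrix.cons_val]; ring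
  · refine ((((h1 5).fun_add (h0 8)).fun_sub (h1 2)).fun_add (h1 7)).congr_deriv ?_
    simp only [dlogNine, dlogOneSubNine, Matrix.cons_val]; ring
  · refine ((((h1 6).fun_sub (h1 1)).fun_sub (h0 8)).fun_add (h1 7)).congr_deriv ?_
    simp only [dlogNine, dlogOneSubNine, Matrix.cons_val]; ring
  · refine (((h0 5).fun_add (h1 8)).fun_sub (h1 7)).congr_deriv ?_
    simp only [dlogNine, dlogOneSubNine, Matrix.cons_val]; ring

theorem weightOne_eq_zero {m : Fin 9 → ℕ → ℂ} (h : weightOne m = 0) :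
    m 0 1 = m 2 1 + m 1 1 - 2 * m 7 1 ∧ m 3 1 = m 2 1 - m 7 1 ∧ m 4 1 = m 1 1 - m 7 1 ∧
      m 5 1 = m 2 1 - m 7 1 - m 8 0 ∧ m 6 1 = m 1 1 - m 7 1 + m 8 0 ∧ m 5 0 = m 7 1 - m 8 1 := by
  have e : ∀ j, weightOne m j = 0 := fun j => congrFun h j
  have e0 : m 0 1 - m 2 1 - m 1 1 + 2 * m 7 1 = 0 := e 0
  have e1 : m 3 1 - m 2 1 + m 7 1 = 0 := e 1
  have e2 : m 4 1 - m 1 1 + m 7 1 = 0 := e 2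
  have e3 : m 5 1 + m 8 0 - m 2 1 + m 7 1 = 0 := e 3
  have e4 : m 6 1 - m 1 1 - m 8 0 + m 7 1 = 0 := e 4
  have e5 : m 5 0 + m 8 1 - m 7 1 = 0 := e 5
  refine ⟨?_, ?_, ?_, ?_, ?_, ?_⟩
  · linear_combination e0
  · linear_combination e1
  · linear_combination e2
  · linear_combination e3
  · linear_combination e4
  · linear_combination e5

/-- The derivatives are linear in the weight one entries. Eliminating the dependent ones by the six
relations makes the coefficients of all logarithmic derivatives vanish. -/
theorem IsNineSystem.weightTwo_eq (hU : IsOpen U) (hU' : IsPreconnected U)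
    (hM : IsNineSystem U M) {s t : ℂ} (hs : s ∈ U) (ht : t ∈ U) (h1 : weightOne (M t) = 0) :
    weightTwo (M s) = weightTwo (M t) := by
  funext j
  refine eq_of_hasDerivAt_zero hU hU' (g := fun s => weightTwo (M s) j) (fun s hs => ?_) hs ht
  obtain ⟨e0, e3, e4, e5, e6, el⟩ := weightOne_eq_zero ((hM.weightOne_eq hU hU' hs ht).trans h1)
  obtain ⟨X, Y, A, B, C, D, h⟩ := hM s hs
  have h0 := fun i => (h i).1
  have h2 := fun i => (h i).2.2 0
  simp only [zero_add] at h2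
  fin_cases j
  · refine ((((((h2 0).fun_add (h2 1)).fun_add (h2 2)).fun_sub ((h2 3).const_mul 2)).fun_sub
      ((h2 4).const_mul 2)).fun_sub ((h2 7).const_mul 2)).congr_deriv ?_
    simp only [dlogNine, Matrix.cons_val, e0, e3, e4]; ring
  · refine (((((((((h2 1).fun_sub (h2 0)).fun_sub (h2 2)).fun_add ((h2 3).const_mul 2)).fun_add
      ((h2 6).const_mul 2)).fun_sub ((h2 8).const_mul 2)).fun_sub
      (((h0 8).fun_mul (h0 5)).const_mul 2)).fun_add ((h0 8).fun_pow 2)).add_const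
      ((Real.pi : ℂ) ^ 2 / 3)).congr_deriv ?_
    simp only [dlogNine, Matrix.cons_val, e0, e3, e6, el]; ring
  · refine ((((((h2 0).fun_sub (h2 3)).fun_sub (h2 4)).fun_sub (h2 5)).fun_sub
      (h2 6)).const_mul 2 |>.fun_sub ((h0 8).fun_pow 2)).congr_deriv ?_
    simp only [dlogNine, Matrix.cons_val, e0, e3, e4, e5, e6]; ring

theorem IsNineSystem.weightThree_eq (hU : IsOpen U) (hU' : IsPreconnected U)
    (hM : IsNineSystem U M) {s t : ℂ} (hs : s ∈ U) (ht : t ∈ U) (h1 : weightOne (M t) = 0)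
    (h2 : weightTwo (M t) = 0) : weightThree (M s) = weightThree (M t) := by
  refine eq_of_hasDerivAt_zero hU hU' (g := fun s => weightThree (M s)) (fun s hs => ?_) hs ht
  have h2 := (hM.weightTwo_eq hU hU' hs ht h1).trans h2
  have e0 : M s 0 2 + M s 1 2 + M s 2 2 - 2 * M s 3 2 - 2 * M s 4 2 - 2 * M s 7 2 = 0 :=
    congrFun h2 0
  have e1 : M s 1 2 - M s 0 2 - M s 2 2 + 2 * M s 3 2 + 2 * M s 6 2 - 2 * M s 8 2
      - 2 * (M s 8 0 * M s 5 0) + M s 8 0 ^ 2 + (Real.pi : ℂ) ^ 2 / 3 = 0 := congrFun h2 1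
  have e2 : 2 * (M s 0 2 - M s 3 2 - M s 4 2 - M s 5 2 - M s 6 2) - M s 8 0 ^ 2 = 0 :=
    congrFun h2 2
  obtain ⟨X, Y, A, B, C, D, h⟩ := hM s hs
  have h0 := fun i => (h i).1
  have h3 := fun i => (h i).2.2 1
  simp only [Nat.reduceAdd] at h3
  refine (((((((((((((h3 0).fun_add (h3 1)).fun_add (h3 2)).fun_sub ((h3 3).const_mul 2)).fun_sub
    ((h3 4).const_mul 2)).fun_sub ((h3 5).const_mul 2)).fun_sub ((h3 6).const_mul 2)).fun_sub
    ((h3 7).const_mul 2)).fun_sub ((h3 8).const_mul 2)).fun_sub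
    (((h0 8).fun_pow 2).fun_mul (h0 5))).fun_add ((h0 8).const_mul ((Real.pi : ℂ) ^ 2 / 3))).fun_add
    (((h0 8).fun_pow 3).const_mul (1 / 3))).add_const (2 * riemannZeta 3)).congr_deriv ?_
  simp only [dlogNine, Matrix.cons_val]
  -- The three dilogarithm relations are the coefficients of the logarithmic derivatives of x, y and
  -- (1 - y)/(1 - x).
  linear_combination X * e0 + Y * e1 + (B - A) * e2

end Conservation

/-! ### The nine families on complex lines -/

/-- Both fᵢ and 1 - fᵢ factor, up to sign, into the equations of the arrangement. The derivative is
therefore written once as fᵢ times a logarithmic derivative, for dz/z, and once as -(1 - fᵢ) times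
one, for dz/(1 - z). -/
theorem hasDerivAt_nineFormula {x y : ℂ → ℂ} {s dx dy : ℂ} (hx : HasDerivAt x dx s)
    (hy : HasDerivAt y dy s)
    (h : x s * y s * (1 - x s) * (1 - y s) * (x s - y s) * (1 - x s * y s) ≠ 0) (i : Fin 9) :
    HasDerivAt (fun s => nineFormula (x s) (y s) i) (nineFormula (x s) (y s) i *
      dlogNine (dx / x s) (dy / y s) (-dx / (1 - x s)) (-dy / (1 - y s)) i) s ∧
    nineFormula (x s) (y s) i *
      dlogNine (dx / x s) (dy / y s) (-dx / (1 - x s)) (-dy / (1 - y s)) i =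
    -((1 - nineFormula (x s) (y s) i) *
      dlogOneSubNine (dy / y s) (-dx / (1 - x s)) (-dy / (1 - y s)) ((dx - dy) / (x s - y s))
        (-(dx * y s + x s * dy) / (1 - x s * y s)) i) := by
  simp only [mul_ne_zero_iff] at h
  obtain ⟨⟨⟨⟨⟨h1, h2⟩, h3⟩, h4⟩, h5⟩, h6⟩ := h
  have h7 : x s - 1 ≠ 0 := by
    rw [← neg_sub]
    exact neg_ne_zero.2 h3
  have gx := hx.const_sub 1
  have gy := hy.const_sub 1
  have kx := hx.sub_const 1
  generalize hX : x s = u at *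
  generalize hY : y s = v at *
  have h8 : 1 - v * u ≠ 0 := by rwa [mul_comm]
  match i with
  | 0 =>
    refine ⟨((hx.fun_mul (gy.fun_pow 2)).fun_div (hy.fun_mul (gx.fun_pow 2)) ?_).congr_deriv ?_, ?_⟩
    · simp [hX, hY, h2, h3]
    all_goals simp only [nineFormula, dlogNine, dlogOneSubNine, Matrix.cons_val, hX, hY]
    all_goals field_simp
    all_goals ring
  | 1 =>
    refine ⟨(hx.fun_mul hy).congr_deriv ?_, ?_⟩
    all_goals simp only [nineFormula, dlogNine, dlogOneSubNine, Matrix.cons_val, hX, hY]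
    all_goals field_simp
  | 2 =>
    refine ⟨(hx.fun_div hy (by rwa [hY])).congr_deriv ?_, ?_⟩
    all_goals simp only [nineFormula, dlogNine, dlogOneSubNine, Matrix.cons_val, hX, hY]
    all_goals field_simp
    all_goals ring
  | 3 =>
    refine ⟨((hx.fun_mul gy).fun_div (hy.fun_mul gx) ?_).congr_deriv ?_, ?_⟩
    · simp [hX, hY, h2, h3]
    all_goals simp only [nineFormula, dlogNine, dlogOneSubNine, Matrix.cons_val, hX, hY]
    all_goals field_simp
    all_goals ring
  | 4 =>
    refine ⟨((hx.fun_mul gy).fun_div kx (by rwa [hX])).congr_deriv ?_, ?_⟩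
    all_goals simp only [nineFormula, dlogNine, dlogOneSubNine, Matrix.cons_val, hX, hY]
    all_goals field_simp
    all_goals ring
  | 5 =>
    refine ⟨(gy.fun_div gx (by rwa [hX])).congr_deriv ?_, ?_⟩
    all_goals simp only [nineFormula, dlogNine, dlogOneSubNine, Matrix.cons_val, hX, hY]
    all_goals field_simp
    all_goals ring
  | 6 =>
    refine ⟨(gy.fun_div (hy.fun_mul kx) ?_).congr_deriv ?_, ?_⟩
    · simp [hX, hY, h2, h7]
    all_goals simp only [nineFormula, dlogNine, dlogOneSubNine, Matrix.cons_val, hX, hY]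
    all_goals field_simp
    all_goals ring
  | 7 =>
    refine ⟨hx.congr_deriv ?_, ?_⟩
    all_goals simp only [nineFormula, dlogNine, dlogOneSubNine, Matrix.cons_val]
    all_goals field_simp
  | 8 =>
    refine ⟨hy.congr_deriv ?_, ?_⟩
    all_goals simp only [nineFormula, dlogNine, dlogOneSubNine, Matrix.cons_val]
    all_goals field_simp


/-- Two nearby points of the arrangement complement are joined by a complex line, parametrised so
that `s = 0` and `s = 1` are the two points. Restricting the nine local branches to it reduces the
two-variable problem to one complex variable, with no differentiability asked of `h`. -/
theorem exists_isNineSystem {X : Type*} [TopologicalSpace X] {h : X → NonFano}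
    (hh : Continuous h) {Φ : X → Fin 9 → ℕ → ℂ}
    (hΦ : ∀ i, IsLocalLift (fun x => nine i (h x)) (fun x => Φ x i)) (x₀ : X) :
    ∀ᶠ x in nhds x₀, ∃ (U : Set ℂ) (M : ℂ → Fin 9 → ℕ → ℂ), IsOpen U ∧ IsPreconnected U ∧
      IsNineSystem U M ∧ 0 ∈ U ∧ 1 ∈ U ∧ M 0 = Φ x₀ ∧ M 1 = Φ x := by
  choose V G hV hV₀ hG he using fun i => hΦ i x₀
  have hopen : IsOpen {p : ℂ × ℂ | p.1 * p.2 * (1 - p.1) * (1 - p.2) * (p.1 - p.2) *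
      (1 - p.1 * p.2) ≠ 0} := isOpen_ne_fun (by fun_prop) (by fun_prop)
  have hS : IsOpen {s : NonFano | ∀ i, (nine i s : ℂ) ∈ V i} := by
    simp only [ofPred_forall]
    exact isOpen_iInter_of_finite fun i =>
      (hV i).preimage (continuous_subtype_val.comp (nine i).continuous)
  -- A ball inside the arrangement complement on which all nine maps stay in the domains of their
  -- branches.
  obtain ⟨r, hr, hball⟩ := Metric.isOpen_iff.1 (hopen.isOpenMap_subtype_val _ hS) (h x₀).1
    ⟨h x₀, hV₀, rfl⟩
  have hx : ∀ᶠ x in nhds x₀, (h x : ℂ × ℂ) ∈ Metric.ball (h x₀ : ℂ × ℂ) r :=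
    (continuous_subtype_val.comp hh).continuousAt.eventually (Metric.ball_mem_nhds _ hr)
  filter_upwards [hx, Filter.eventually_all.2 he] with x hx hex
  set p : ℂ × ℂ := (h x₀).1
  set v : ℂ × ℂ := (h x).1 - p
  have hmem : ∀ s : ℂ, s • v ∈ Metric.ball (0 : ℂ × ℂ) r →
      ∃ q : NonFano, q.1.1 = p.1 + s * v.1 ∧ q.1.2 = p.2 + s * v.2 ∧
        ∀ i, (nine i q : ℂ) ∈ V i := by
    intro s hs
    have : p + s • v ∈ Metric.ball p r := by
      rw [Metric.mem_ball, dist_self_add_left]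
      simpa using hs
    obtain ⟨q, hq, hqe⟩ := hball this
    exact ⟨q, congrArg Prod.fst hqe, congrArg Prod.snd hqe, hq⟩
  refine ⟨(fun s : ℂ => s • v) ⁻¹' Metric.ball (0 : ℂ × ℂ) r,
    fun s i => G i (nineFormula (p.1 + s * v.1) (p.2 + s * v.2) i),
    Metric.isOpen_ball.preimage (by fun_prop), ?_, ?_, ?_, ?_, ?_, ?_⟩
  · exact ((convex_ball (0 : ℂ × ℂ) r).is_linear_preimage
      ⟨fun a b => add_smul a b v, fun c a => smul_assoc c a v⟩).isPreconnected
  · intro s hs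
    obtain ⟨q, hq1, hq2, hqV⟩ := hmem s hs
    have hx' : HasDerivAt (fun s : ℂ => p.1 + s * v.1) v.1 s := by
      simpa using ((hasDerivAt_id s).mul_const v.1).const_add p.1
    have hy' : HasDerivAt (fun s : ℂ => p.2 + s * v.2) v.2 s := by
      simpa using ((hasDerivAt_id s).mul_const v.2).const_add p.2
    have hd := hasDerivAt_nineFormula hx' hy' (by rw [← hq1, ← hq2]; exact q.2)
    refine ⟨v.1 / (p.1 + s * v.1), v.2 / (p.2 + s * v.2), -v.1 / (1 - (p.1 + s * v.1)),
      -v.2 / (1 - (p.2 + s * v.2)), (v.1 - v.2) / (p.1 + s * v.1 - (p.2 + s * v.2)),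
      -(v.1 * (p.2 + s * v.2) + (p.1 + s * v.1) * v.2) / (1 - (p.1 + s * v.1) * (p.2 + s * v.2)),
      fun i => ?_⟩
    obtain ⟨hd1, hd2⟩ := hd i
    have hm : nineFormula (p.1 + s * v.1) (p.2 + s * v.2) i = (nine i q : ℂ) := by
      rw [nine_apply, hq1, hq2]
    have hn0 : nineFormula (p.1 + s * v.1) (p.2 + s * v.2) i ≠ 0 := hm ▸ (nine i q).2.1
    have hn1 : 1 - nineFormula (p.1 + s * v.1) (p.2 + s * v.2) i ≠ 0 :=
      sub_ne_zero.2 (hm ▸ (nine i q).2.2).symm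
    have hc := fun k => (hG i _ (hm.symm ▸ hqV i) k).comp_of_eq s hd1 rfl
    refine ⟨(hc 0).congr_deriv ?_, (hc 1).congr_deriv ?_, fun k => (hc (k + 2)).congr_deriv ?_⟩
    · simp only [rate]
      rw [one_div, inv_mul_cancel_left₀ hn0]
    · rw [hd2]
      simp only [rate]
      rw [one_div, mul_neg, inv_mul_cancel_left₀ hn1]
    · simp only [rate]
      rw [div_mul_eq_mul_div, mul_left_comm, mul_div_cancel_left₀ _ hn0]
  · simpa using hr
  · rw [mem_preimage, one_smul, Metric.mem_ball, dist_zero_right, ← dist_eq_norm]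
    exact hx
  · funext i
    have e : Φ x₀ i = G i (nine i (h x₀)) := (he i).self_of_nhds
    rw [e, nine_apply]
    simp [p]
  · funext i
    rw [hex i, nine_apply]
    simp [v]

/-! ### Constancy over connected parameter spaces -/

section Global

variable {X : Type*} [TopologicalSpace X] [PreconnectedSpace X] {h : X → NonFano}
  {Φ : X → Fin 9 → ℕ → ℂ}

/-- The parameter space is arbitrary because two are needed: the interval of the curve (t², t), and
the unit interval of a path ending at the given point. -/
theorem weightOne_constant (hh : Continuous h)
    (hΦ : ∀ i, IsLocalLift (fun x => nine i (h x)) (fun x => Φ x i)) (x y : X) :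
    weightOne (Φ x) = weightOne (Φ y) := by
  refine IsLocallyConstant.apply_eq_of_preconnectedSpace (f := fun x => weightOne (Φ x))
    ((IsLocallyConstant.iff_eventually_eq _).2 fun x₀ => ?_) x y
  filter_upwards [exists_isNineSystem hh hΦ x₀] with x hx
  obtain ⟨U, M, hU, hU', hM, h0, h1, e0, e1⟩ := hx
  rw [← e0, ← e1]
  exact hM.weightOne_eq hU hU' h1 h0

theorem weightTwo_constant (hh : Continuous h)
    (hΦ : ∀ i, IsLocalLift (fun x => nine i (h x)) (fun x => Φ x i))
    (hone : ∀ x, weightOne (Φ x) = 0) (x y : X) :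
    weightTwo (Φ x) = weightTwo (Φ y) := by
  refine IsLocallyConstant.apply_eq_of_preconnectedSpace (f := fun x => weightTwo (Φ x))
    ((IsLocallyConstant.iff_eventually_eq _).2 fun x₀ => ?_) x y
  filter_upwards [exists_isNineSystem hh hΦ x₀] with x hx
  obtain ⟨U, M, hU, hU', hM, h0, h1, e0, e1⟩ := hx
  rw [← e0, ← e1]
  exact hM.weightTwo_eq hU hU' h1 h0 (by rw [e0, hone])

theorem weightThree_constant (hh : Continuous h)
    (hΦ : ∀ i, IsLocalLift (fun x => nine i (h x)) (fun x => Φ x i))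
    (hone : ∀ x, weightOne (Φ x) = 0) (htwo : ∀ x, weightTwo (Φ x) = 0) (x y : X) :
    weightThree (Φ x) = weightThree (Φ y) := by
  refine IsLocallyConstant.apply_eq_of_preconnectedSpace (f := fun x => weightThree (Φ x))
    ((IsLocallyConstant.iff_eventually_eq _).2 fun x₀ => ?_) x y
  filter_upwards [exists_isNineSystem hh hΦ x₀] with x hx
  obtain ⟨U, M, hU, hU', hM, h0, h1, e0, e1⟩ := hx
  rw [← e0, ← e1]
  exact hM.weightThree_eq hU hU' h1 h0 (by rw [e0, hone]) (by rw [e0, htwo])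

end Global

/-! ### The values along the tangential base point -/

/-- The nine paths `δ`. -/
def deltaNine : ∀ i : Fin 9, TangentialConnection base01 ((nine i).comp baseV)
  | 0 => deltaUnit (f₁.comp baseV) f₁_bound
  | 1 => deltaUnit (f₂.comp baseV) f₂_bound
  | 2 => deltaUnit (f₃.comp baseV) f₃_bound
  | 3 => deltaUnit (f₄.comp baseV) f₄_bound
  | 4 => deltaUpper (f₅.comp baseV) f₅_bound
  | 5 => deltaUnit (f₆.comp baseV) f₆_bound
  | 6 => deltaUpper (f₇.comp baseV) f₇_bound
  | 7 => deltaUnit (f₈.comp baseV) f₈_bound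
  | 8 => deltaUnit (f₉.comp baseV) f₉_bound

/-- The values at `f (t², t)` of the polylogarithms continued along `δ`, for the nine maps `f`. -/
def baseValue (t : UnitOpen) (i : Fin 9) : ℕ → ℂ := connectionValue (deltaNine i) t

/-- The nine images of `(t², t)`. -/
def baseReal (t : ℝ) : Fin 9 → ℝ :=
  ![t / (1 + t) ^ 2, t ^ 3, t, t / (1 + t), -(t ^ 2 / (1 + t)), 1 / (1 + t), -(1 / (t * (1 + t))),
    t ^ 2, t]

theorem isLocalLift_baseValue (i : Fin 9) :
    IsLocalLift (fun t => nine i (baseV t)) (fun t => baseValue t i) :=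
  isLocalLift_connectionValue (deltaNine i)

theorem nine_baseV (t : UnitOpen) (i : Fin 9) :
    (nine i (baseV t) : ℂ) = ((baseReal t i : ℝ) : ℂ) := by
  match i with
  | 0 => exact f₁_baseV t
  | 1 => exact f₂_baseV t
  | 2 => exact f₃_baseV t
  | 3 => exact f₄_baseV t
  | 4 => exact f₅_baseV t
  | 5 => exact f₆_baseV t
  | 6 => exact f₇_baseV t
  | 7 => exact f₈_baseV t
  | 8 => exact f₉_baseV t

theorem connectionValue_deltaUnit_succ {b : C(UnitOpen, Line)}
    (hb : ∀ t, (b t : ℂ).im = 0 ∧ 0 < (b t : ℂ).re ∧ (b t : ℂ).re < 1) (t : UnitOpen) (k : ℕ) :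
    connectionValue (deltaUnit b hb) t (k + 1) = polylogSeries (k + 1) (b t) := by
  rw [connectionValue_deltaUnit, principal, ← Complex.ofReal_exp, Real.exp_log (hb t).2.1]
  congr 1
  apply Complex.ext <;> simp [(hb t).1]

theorem connectionValue_deltaUpper_succ {b : C(UnitOpen, Line)}
    (hb : ∀ t, (b t : ℂ).im = 0 ∧ (b t : ℂ).re < 0) (t : UnitOpen) (ht : -1 < (b t : ℂ).re)
    (k : ℕ) : connectionValue (deltaUpper b hb) t (k + 1) = polylogSeries (k + 1) (b t) := by
  rw [connectionValue_deltaUpper b hb t ht, principal, Complex.exp_add, Complex.exp_pi_mul_I,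
    ← Complex.ofReal_exp, Real.exp_log (neg_pos.2 (hb t).2)]
  congr 1
  apply Complex.ext <;> simp [(hb t).1]

theorem baseReal_four_gt (t : UnitOpen) : -1 < baseReal t 4 := by
  obtain ⟨t, h0, h1⟩ := t
  change -1 < -(t ^ 2 / (1 + t))
  rw [neg_lt_neg_iff, div_lt_one (by positivity)]
  nlinarith

theorem baseReal_six_gt {t : ℝ} (h0 : 0 < t) (ht : 1 < t * (1 + t)) : -1 < baseReal t 6 := by
  change -1 < -(1 / (t * (1 + t)))
  rw [neg_lt_neg_iff, div_lt_one (by positivity)]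
  exact ht

/-- For the seventh map the arc stays in the unit disc only while 1/(t(1 + t)) < 1, which excludes
small `t`. -/
theorem baseValue_succ (t : UnitOpen) (i : Fin 9) (h : i ≠ 6 ∨ 1 < (t : ℝ) * (1 + t)) (k : ℕ) :
    baseValue t i (k + 1) = polylogSeries (k + 1) ((baseReal t i : ℝ) : ℂ) := by
  rw [← nine_baseV]
  match i, h with
  | 0, _ => exact connectionValue_deltaUnit_succ f₁_bound t k
  | 1, _ => exact connectionValue_deltaUnit_succ f₂_bound t k
  | 2, _ => exact connectionValue_deltaUnit_succ f₃_bound t k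
  | 3, _ => exact connectionValue_deltaUnit_succ f₄_bound t k
  | 4, _ =>
    refine connectionValue_deltaUpper_succ f₅_bound t ?_ k
    rw [ContinuousMap.comp_apply, f₅_baseV t, Complex.ofReal_re]
    exact baseReal_four_gt t
  | 5, _ => exact connectionValue_deltaUnit_succ f₆_bound t k
  | 6, h =>
    refine connectionValue_deltaUpper_succ f₇_bound t ?_ k
    rw [ContinuousMap.comp_apply, f₇_baseV t, Complex.ofReal_re]
    exact baseReal_six_gt t.2.1 (h.resolve_left fun h => h rfl)
  | 7, _ => exact connectionValue_deltaUnit_succ f₈_bound t k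
  | 8, _ => exact connectionValue_deltaUnit_succ f₉_bound t k

theorem baseValue_five_zero (t : UnitOpen) :
    baseValue t 5 0 = -((Real.log (1 + t) : ℝ) : ℂ) := by
  change connectionValue (deltaUnit (f₆.comp baseV) f₆_bound) t 0 = _
  rw [connectionValue_deltaUnit, principal, ContinuousMap.comp_apply, f₆_baseV, Complex.ofReal_re,
    one_div, Real.log_inv, Complex.ofReal_neg]

theorem baseValue_eight_zero (t : UnitOpen) :
    baseValue t 8 0 = ((Real.log t : ℝ) : ℂ) := by
  change connectionValue (deltaUnit (f₉.comp baseV) f₉_bound) t 0 = _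
  rw [connectionValue_deltaUnit, principal, ContinuousMap.comp_apply, f₉_baseV, Complex.ofReal_re]

theorem polylogSeries_one_ofReal {b : ℝ} (h0 : -1 < b) (h1 : b < 1) :
    polylogSeries 1 b = -((Real.log (1 - b) : ℝ) : ℂ) := by
  rw [polylogSeries_one (by rw [Complex.norm_real, Real.norm_eq_abs, abs_lt]; exact ⟨h0, h1⟩),
    Complex.ofReal_log (by linarith)]
  push_cast
  rfl

instance : PreconnectedSpace UnitOpen :=
  isPreconnected_iff_preconnectedSpace.1 isPreconnected_Ioo

theorem weightOne_baseValue (t : UnitOpen) : weightOne (baseValue t) = 0 := by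
  -- Here τ(1 + τ) = 21/16 > 1, so all nine values are given by the series, and every logarithm that
  -- occurs is an integer combination of those of 2, 3, 7 and 37.
  let τ : UnitOpen := ⟨3 / 4, by norm_num, by norm_num⟩
  rw [weightOne_constant baseV.continuous isLocalLift_baseValue t τ]
  have e : ∀ i, baseValue τ i 1 = polylogSeries 1 ((baseReal τ i : ℝ) : ℂ) := fun i =>
    baseValue_succ τ i (Or.inr (by norm_num [τ])) 0
  have hl : ∀ (i : Fin 9) (b : ℝ), baseReal τ i = b → -1 < b → b < 1 →
      baseValue τ i 1 = -((Real.log (1 - b) : ℝ) : ℂ) := by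
    intro i b hb h0 h1
    rw [e, hb, polylogSeries_one_ofReal h0 h1]
  have e0 := hl 0 (12 / 49) (by simp only [baseReal, Matrix.cons_val, τ]; norm_num) (by norm_num) (by norm_num)
  have e1 := hl 1 (27 / 64) (by simp only [baseReal, Matrix.cons_val, τ]; norm_num) (by norm_num) (by norm_num)
  have e2 := hl 2 (3 / 4) (by simp only [baseReal, Matrix.cons_val, τ]) (by norm_num) (by norm_num)
  have e3 := hl 3 (3 / 7) (by simp only [baseReal, Matrix.cons_val, τ]; norm_num) (by norm_num) (by norm_num)
  have e4 := hl 4 (-9 / 28) (by simp only [baseReal, Matrix.cons_val, τ]; norm_num) (by norm_num) (by norm_num)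
  have e5 := hl 5 (4 / 7) (by simp only [baseReal, Matrix.cons_val, τ]; norm_num) (by norm_num) (by norm_num)
  have e6 := hl 6 (-16 / 21) (by simp only [baseReal, Matrix.cons_val, τ]; norm_num) (by norm_num) (by norm_num)
  have e7 := hl 7 (9 / 16) (by simp only [baseReal, Matrix.cons_val, τ]; norm_num) (by norm_num) (by norm_num)
  have e8 := hl 8 (3 / 4) (by simp only [baseReal, Matrix.cons_val, τ]) (by norm_num) (by norm_num)
  have l5 : baseValue τ 5 0 = -((Real.log (7 / 4) : ℝ) : ℂ) := by
    rw [baseValue_five_zero]; norm_num [τ]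
  have l8 : baseValue τ 8 0 = ((Real.log (3 / 4) : ℝ) : ℂ) := by
    rw [baseValue_eight_zero]
  have p4 : Real.log 4 = 2 * Real.log 2 := by
    rw [show (4 : ℝ) = 2 ^ 2 by norm_num, Real.log_pow]; norm_num
  have p16 : Real.log 16 = 4 * Real.log 2 := by
    rw [show (16 : ℝ) = 2 ^ 4 by norm_num, Real.log_pow]; norm_num
  have p64 : Real.log 64 = 6 * Real.log 2 := by
    rw [show (64 : ℝ) = 2 ^ 6 by norm_num, Real.log_pow]; norm_num
  have p49 : Real.log 49 = 2 * Real.log 7 := by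
    rw [show (49 : ℝ) = 7 ^ 2 by norm_num, Real.log_pow]; norm_num
  have p28 : Real.log 28 = 2 * Real.log 2 + Real.log 7 := by
    rw [show (28 : ℝ) = 4 * 7 by norm_num, Real.log_mul (by norm_num) (by norm_num), p4]
  have p21 : Real.log 21 = Real.log 3 + Real.log 7 := by
    rw [show (21 : ℝ) = 3 * 7 by norm_num, Real.log_mul (by norm_num) (by norm_num)]
  have q0 : Real.log (1 - 12 / 49) = Real.log 37 - 2 * Real.log 7 := by
    rw [← p49, ← Real.log_div (by norm_num) (by norm_num)]; norm_num
  have q1 : Real.log (1 - 27 / 64) = Real.log 37 - 6 * Real.log 2 := by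
    rw [← p64, ← Real.log_div (by norm_num) (by norm_num)]; norm_num
  have q2 : Real.log (1 - 3 / 4) = -(2 * Real.log 2) := by
    rw [← p4, ← Real.log_inv]; norm_num
  have q3 : Real.log (1 - 3 / 7) = 2 * Real.log 2 - Real.log 7 := by
    rw [← p4, ← Real.log_div (by norm_num) (by norm_num)]; norm_num
  have q4 : Real.log (1 - -9 / 28) = Real.log 37 - (2 * Real.log 2 + Real.log 7) := by
    rw [← p28, ← Real.log_div (by norm_num) (by norm_num)]; norm_num
  have q5 : Real.log (1 - 4 / 7) = Real.log 3 - Real.log 7 := by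
    rw [← Real.log_div (by norm_num) (by norm_num)]; norm_num
  have q6 : Real.log (1 - -16 / 21) = Real.log 37 - (Real.log 3 + Real.log 7) := by
    rw [← p21, ← Real.log_div (by norm_num) (by norm_num)]; norm_num
  have q7 : Real.log (1 - 9 / 16) = Real.log 7 - 4 * Real.log 2 := by
    rw [← p16, ← Real.log_div (by norm_num) (by norm_num)]; norm_num
  have r5 : Real.log (7 / 4) = Real.log 7 - 2 * Real.log 2 := by
    rw [← p4, ← Real.log_div (by norm_num) (by norm_num)]
  have r8 : Real.log (3 / 4) = Real.log 3 - 2 * Real.log 2 := by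
    rw [← p4, ← Real.log_div (by norm_num) (by norm_num)]
  rw [q0] at e0
  rw [q1] at e1
  rw [q2] at e2 e8
  rw [q3] at e3
  rw [q4] at e4
  rw [q5] at e5
  rw [q6] at e6
  rw [q7] at e7
  rw [r5] at l5
  rw [r8] at l8
  funext j
  match j with
  | 0 => simp only [weightOne, Matrix.cons_val, e0, e1, e2, e7, Pi.zero_apply]; push_cast; ring
  | 1 => simp only [weightOne, Matrix.cons_val, e3, e2, e7, Pi.zero_apply]; push_cast; ring
  | 2 => simp only [weightOne, Matrix.cons_val, e4, e1, e7, Pi.zero_apply]; push_cast; ring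
  | 3 => simp only [weightOne, Matrix.cons_val, e5, l8, e2, e7, Pi.zero_apply]; push_cast; ring
  | 4 => simp only [weightOne, Matrix.cons_val, e6, l8, e1, e7, Pi.zero_apply]; push_cast; ring
  | 5 => simp only [weightOne, Matrix.cons_val, l5, e8, e7, Pi.zero_apply]; push_cast; ring

/-! ### The inversion relation on the curve `t ↦ -1 / (t (1 + t))` -/

/-- The weight one relations hold for every `t`, so they give Li₁ on the seventh curve even where
its argument has left the unit disc. This starts the inversion argument. -/
theorem baseValue_six_one (t : UnitOpen) :
    baseValue t 6 1 =
      ((Real.log (t * (1 + t)) - Real.log (1 + t * (1 + t)) : ℝ) : ℂ) := by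
  have h := (weightOne_eq_zero (weightOne_baseValue t)).2.2.2.2.1
  have h1 := baseValue_succ t 1 (Or.inl (by decide)) 0
  have h7 := baseValue_succ t 7 (Or.inl (by decide)) 0
  rw [zero_add] at h1 h7
  obtain ⟨t, t0, t1⟩ := t
  change _ = polylogSeries 1 ((t ^ 3 : ℝ) : ℂ) at h1
  change _ = polylogSeries 1 ((t ^ 2 : ℝ) : ℂ) at h7
  have g2 : t ^ 2 < 1 := by nlinarith
  have g3 : t ^ 3 < 1 := by nlinarith [mul_pos t0 t0]
  rw [polylogSeries_one_ofReal (by linarith [pow_pos t0 3]) g3] at h1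
  rw [polylogSeries_one_ofReal (by linarith [pow_pos t0 2]) g2] at h7
  rw [h, h1, h7, baseValue_eight_zero]
  have a1 : Real.log (1 - t ^ 3) = Real.log (1 - t) + Real.log (1 + t * (1 + t)) := by
    rw [← Real.log_mul (by linarith) (by positivity)]
    ring_nf
  have a2 : Real.log (1 - t ^ 2) = Real.log (1 - t) + Real.log (1 + t) := by
    rw [← Real.log_mul (by linarith) (by positivity)]
    ring_nf
  have a3 : Real.log (t * (1 + t)) = Real.log t + Real.log (1 + t) :=
    Real.log_mul t0.ne' (by positivity)
  rw [a1, a2, a3]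
  push_cast
  ring

/-- The values of the polylogarithms on the seventh curve, as a function of a real variable. -/
def curveValue (t : ℝ) (k : ℕ) : ℂ :=
  -- The value outside (0, 1) plays no role: derivatives are only taken at points of this open
  -- interval.
  if h : t ∈ Ioo (0 : ℝ) 1 then baseValue ⟨t, h⟩ 6 k else 0

theorem hasDerivAt_curveValue {t : ℝ} (ht : t ∈ Ioo (0 : ℝ) 1) (k : ℕ) :
    HasDerivAt (fun s => curveValue s (k + 2))
      (-(curveValue t (k + 1)) * (((1 + 2 * t) / (t * (1 + t)) : ℝ) : ℂ)) t := by
  obtain ⟨U, G, hU, hxU, hG, he⟩ := isLocalLift_baseValue 6 ⟨t, ht⟩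
  have ht1 : 1 + t ≠ 0 := by linarith [ht.1]
  have hne : t * (1 + t) ≠ 0 := mul_ne_zero ht.1.ne' ht1
  have hb : HasDerivAt (fun s : ℝ => ((-(1 / (s * (1 + s))) : ℝ) : ℂ))
      (((1 + 2 * t) / (t * (1 + t)) ^ 2 : ℝ) : ℂ) t := by
    have h1 := (hasDerivAt_id t).fun_mul ((hasDerivAt_id t).const_add 1)
    have h2 := ((hasDerivAt_const t (1 : ℝ)).fun_div h1 hne).fun_neg
    refine (h2.congr_deriv ?_).ofReal_comp
    simp only [id]
    field_simp
    ring
  have e : ((-(1 / (t * (1 + t))) : ℝ) : ℂ) = (nine 6 (baseV ⟨t, ht⟩) : ℂ) :=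
    (nine_baseV ⟨t, ht⟩ 6).symm
  have hc := (hG _ hxU (k + 2)).comp_of_eq t hb e.symm
  have hG1 : curveValue t (k + 1) = G (nine 6 (baseV ⟨t, ht⟩)) (k + 1) := by
    rw [curveValue, dif_pos ht]
    exact congrFun he.self_of_nhds (k + 1)
  have hev : (fun s => curveValue s (k + 2)) =ᶠ[nhds t]
      ((fun w => G w (k + 2)) ∘ fun s : ℝ => ((-(1 / (s * (1 + s))) : ℝ) : ℂ)) := by
    have := (isOpen_Ioo.isOpenEmbedding_subtypeVal.map_nhds_eq
      (⟨t, ht⟩ : UnitOpen)).symm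
    change ∀ᶠ s in nhds (((⟨t, ht⟩ : UnitOpen) : ℝ)), _
    rw [this, Filter.eventually_map]
    filter_upwards [he] with s hs
    rw [curveValue, dif_pos s.2]
    refine (congrFun hs (k + 2)).trans ?_
    exact congrArg (fun w => G w (k + 2)) (nine_baseV s 6)
  refine (hc.congr_of_eventuallyEq hev).congr_deriv ?_
  rw [hG1, rate]
  change G (nine 6 (baseV ⟨t, ht⟩)) (k + 1) / (nine 6 (baseV ⟨t, ht⟩)) * _ = _
  rw [← e, div_mul_eq_mul_div, mul_div_assoc, ← Complex.ofReal_div, neg_mul_comm,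
    ← Complex.ofReal_neg]
  congr 2
  field_simp

theorem exists_threshold : ∃ τ ∈ Ioo (0 : ℝ) 1, τ * (1 + τ) = 1 := by
  have h5 : √5 ^ 2 = 5 := Real.sq_sqrt (by norm_num)
  have h0 := Real.sqrt_nonneg 5
  -- The inverse golden ratio, where the seventh curve passes through -1.
  refine ⟨(√5 - 1) / 2, ⟨by nlinarith, by nlinarith⟩, by nlinarith⟩

theorem tendsto_polylogSeries {l : Filter ℝ} {β : ℝ → ℝ} {b : ℝ} (k : ℕ)
    (hβ : Filter.Tendsto β l (nhds b)) (hl : ∀ᶠ t in l, |β t| ≤ 1) (hb : |b| ≤ 1) :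
    Filter.Tendsto (fun t => polylogSeries (k + 2) (β t)) l (nhds (polylogSeries (k + 2) b)) := by
  have h := continuousOn_polylogSeries k (b : ℂ) (by simpa using hb)
  refine h.tendsto.comp (tendsto_nhdsWithin_iff.2 ⟨?_, ?_⟩)
  · exact (Complex.continuous_ofReal.tendsto b).comp hβ
  · filter_upwards [hl] with t ht
    simpa using ht

/-- To the right of `τ` the seventh argument lies in the unit disc and the series applies;
continuity of both sides gives the value at -1. -/
theorem curveValue_threshold {τ : ℝ} (hτ : τ ∈ Ioo (0 : ℝ) 1) (h1 : τ * (1 + τ) = 1) (k : ℕ) :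
    curveValue τ (k + 2) = polylogSeries (k + 2) (-1) := by
  have hc : Filter.Tendsto (fun t => curveValue t (k + 2)) (nhdsWithin τ (Ioi τ))
      (nhds (curveValue τ (k + 2))) :=
    (hasDerivAt_curveValue hτ k).continuousAt.continuousWithinAt
  have hu : ∀ t, τ < t → 1 < t * (1 + t) := fun t ht => by nlinarith [hτ.1]
  have hs : Filter.Tendsto (fun t : ℝ => polylogSeries (k + 2) ((-(1 / (t * (1 + t))) : ℝ) : ℂ))
      (nhdsWithin τ (Ioi τ)) (nhds (polylogSeries (k + 2) ((-1 : ℝ) : ℂ))) := by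
    refine tendsto_polylogSeries k ?_ ?_ (by norm_num)
    · have : ContinuousAt (fun t : ℝ => -(1 / (t * (1 + t)))) τ := by
        refine (ContinuousAt.div continuousAt_const (by fun_prop) ?_).neg
        rw [h1]
        exact one_ne_zero
      have h2 := this.continuousWithinAt (s := Ioi τ)
      rw [ContinuousWithinAt, h1, div_one] at h2
      exact h2
    · filter_upwards [self_mem_nhdsWithin] with t ht
      have := hu t ht
      rw [abs_neg, abs_of_pos (by positivity), div_le_one (by linarith)]
      exact this.le
  have he : ∀ᶠ t : ℝ in nhdsWithin τ (Ioi τ), polylogSeries (k + 2)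
      ((-(1 / (t * (1 + t))) : ℝ) : ℂ) = curveValue t (k + 2) := by
    filter_upwards [Ioo_mem_nhdsGT hτ.2] with t ht
    have ht' : t ∈ Ioo (0 : ℝ) 1 := ⟨hτ.1.trans ht.1, ht.2⟩
    rw [curveValue, dif_pos ht']
    exact (baseValue_succ ⟨t, ht'⟩ 6 (Or.inr (hu t ht.1)) (k + 1)).symm
  have := tendsto_nhds_unique hc (hs.congr' he)
  rw [this]
  norm_num

theorem hasDerivAt_polylogSeries_neg (k : ℕ) {t : ℝ} (h0 : 0 < t) (h1 : t * (1 + t) < 1) :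
    HasDerivAt (fun s : ℝ => polylogSeries (k + 1) ((-(s * (1 + s)) : ℝ) : ℂ))
      (polylogSeries k ((-(t * (1 + t)) : ℝ) : ℂ) * (((1 + 2 * t) / (t * (1 + t)) : ℝ) : ℂ)) t := by
  have hu : 0 < t * (1 + t) := by positivity
  have h2 : HasDerivAt (fun s : ℝ => ((-(s * (1 + s)) : ℝ) : ℂ)) ((-(1 + 2 * t) : ℝ) : ℂ) t := by
    have := ((hasDerivAt_id t).fun_mul ((hasDerivAt_id t).const_add 1)).fun_neg
    refine (this.congr_deriv ?_).ofReal_comp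
    simp only [id]
    ring
  have h3 : ‖((-(t * (1 + t)) : ℝ) : ℂ)‖ < 1 := by
    rwa [Complex.norm_real, norm_neg, Real.norm_of_nonneg hu.le]
  have h4 : ((-(t * (1 + t)) : ℝ) : ℂ) ≠ 0 := Complex.ofReal_ne_zero.2 (neg_ne_zero.2 hu.ne')
  refine ((hasDerivAt_polylogSeries k h3 h4).comp_of_eq t h2 rfl).congr_deriv ?_
  rw [div_mul_eq_mul_div, mul_div_assoc, ← Complex.ofReal_div, neg_div_neg_eq]

theorem hasDerivAt_log_curve {t : ℝ} (h0 : 0 < t) :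
    HasDerivAt (fun s : ℝ => ((Real.log (s * (1 + s)) : ℝ) : ℂ))
      (((1 + 2 * t) / (t * (1 + t)) : ℝ) : ℂ) t := by
  have hu : t * (1 + t) ≠ 0 := by positivity
  have := ((hasDerivAt_id t).fun_mul ((hasDerivAt_id t).const_add 1)).log hu
  refine (this.congr_deriv ?_).ofReal_comp
  simp only [id]
  congr 1
  ring

theorem continuousOn_polylogSeries_neg (k : ℕ) {a b : ℝ} (ha : 0 < a) (hb : b * (1 + b) ≤ 1) :
    ContinuousOn (fun s : ℝ => polylogSeries (k + 2) ((-(s * (1 + s)) : ℝ) : ℂ)) (Icc a b) := by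
  refine (continuousOn_polylogSeries k).comp (Continuous.continuousOn (by fun_prop)) fun s hs => ?_
  have hs0 := ha.trans_le hs.1
  rw [mem_closedBall_zero_iff, Complex.norm_real, norm_neg, Real.norm_of_nonneg (by positivity)]
  nlinarith [hs.2]

theorem continuousOn_curveValue (k : ℕ) {a b : ℝ} (ha : 0 < a) (hb : b < 1) :
    ContinuousOn (fun s => curveValue s (k + 2)) (Icc a b) := fun _ hs =>
  (hasDerivAt_curveValue ⟨ha.trans_le hs.1, hs.2.trans_lt hb⟩ k).continuousAt.continuousWithinAt

theorem curveValue_one {t : ℝ} (ht : t ∈ Ioo (0 : ℝ) 1) :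
    curveValue t 1 = ((Real.log (t * (1 + t)) - Real.log (1 + t * (1 + t)) : ℝ) : ℂ) := by
  rw [curveValue, dif_pos ht, baseValue_six_one]

/-- The right endpoint is left out of the derivative condition since it will be `τ`, where the
series is evaluated on the unit circle and only continuity is available. -/
theorem eq_of_hasDerivAt_zero_real {g : ℝ → ℂ} {a b : ℝ} (hab : a ≤ b)
    (hc : ContinuousOn g (Icc a b)) (hd : ∀ s ∈ Ico a b, HasDerivAt g 0 s) : g a = g b :=
  (constant_of_has_deriv_right_zero hc (fun s hs => (hd s hs).hasDerivWithinAt) b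
    (right_mem_Icc.2 hab)).symm

/-- Inversion of the dilogarithm in u = t(1 + t): the sum of the two dilogarithms and half the
squared logarithm has derivative zero, and at u = 1 it equals 2 Li₂(-1) = -π²/6. -/
theorem curveValue_two {t : ℝ} (ht : 0 < t) (hu : t * (1 + t) ≤ 1) :
    curveValue t 2 = -((Real.pi : ℂ) ^ 2 / 6) - polylogSeries 2 ((-(t * (1 + t)) : ℝ) : ℂ) -
      1 / 2 * ((Real.log (t * (1 + t)) : ℝ) : ℂ) ^ 2 := by
  obtain ⟨τ, hτ, hτ1⟩ := exists_threshold
  have htτ : t ≤ τ := by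
    by_contra h
    push Not at h
    nlinarith [hτ.1]
  have key := eq_of_hasDerivAt_zero_real (g := fun s => curveValue s 2 +
      polylogSeries 2 ((-(s * (1 + s)) : ℝ) : ℂ) +
      1 / 2 * ((Real.log (s * (1 + s)) : ℝ) : ℂ) ^ 2) htτ
    (((continuousOn_curveValue 0 ht hτ.2).add (continuousOn_polylogSeries_neg 0 ht hτ1.le)).add
      (continuousOn_const.mul (ContinuousOn.pow (fun s hs =>
        (hasDerivAt_log_curve (ht.trans_le hs.1)).continuousAt.continuousWithinAt) 2)))
    (fun s hs => by
      have s0 : 0 < s := ht.trans_le hs.1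
      have s1 : s * (1 + s) < 1 := by nlinarith [hs.2]
      have sI : s ∈ Ioo (0 : ℝ) 1 := ⟨s0, hs.2.trans hτ.2⟩
      refine (((hasDerivAt_curveValue sI 0).fun_add (hasDerivAt_polylogSeries_neg 1 s0 s1)).fun_add
        (((hasDerivAt_log_curve s0).fun_pow 2).const_mul (1 / 2))).congr_deriv ?_
      rw [zero_add, curveValue_one sI, polylogSeries_one_ofReal (by linarith) (by nlinarith),
        sub_neg_eq_add]
      push_cast
      ring)
  have h2 := curveValue_threshold hτ hτ1 0
  rw [zero_add] at h2
  simp only [hτ1, h2, Real.log_one] at key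
  have e : ((-1 : ℝ) : ℂ) = -1 := by norm_num
  rw [e, polylogSeries_two_neg_one, Complex.ofReal_zero] at key
  linear_combination key

/-- The derivative vanishes by the dilogarithm inversion. At u = 1 the two trilogarithms cancel and
the logarithm is zero, so the value Li₃(-1) is not needed. -/
theorem curveValue_three {t : ℝ} (ht : 0 < t) (hu : t * (1 + t) ≤ 1) :
    curveValue t 3 = polylogSeries 3 ((-(t * (1 + t)) : ℝ) : ℂ) +
      (Real.pi : ℂ) ^ 2 / 6 * ((Real.log (t * (1 + t)) : ℝ) : ℂ) +
      1 / 6 * ((Real.log (t * (1 + t)) : ℝ) : ℂ) ^ 3 := by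
  obtain ⟨τ, hτ, hτ1⟩ := exists_threshold
  have htτ : t ≤ τ := by
    by_contra h
    push Not at h
    nlinarith [hτ.1]
  have hlc : ContinuousOn (fun s : ℝ => ((Real.log (s * (1 + s)) : ℝ) : ℂ)) (Icc t τ) :=
    fun s hs => (hasDerivAt_log_curve (ht.trans_le hs.1)).continuousAt.continuousWithinAt
  have key := eq_of_hasDerivAt_zero_real (g := fun s => curveValue s 3 -
      polylogSeries 3 ((-(s * (1 + s)) : ℝ) : ℂ) -
      (Real.pi : ℂ) ^ 2 / 6 * ((Real.log (s * (1 + s)) : ℝ) : ℂ) -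
      1 / 6 * ((Real.log (s * (1 + s)) : ℝ) : ℂ) ^ 3) htτ
    ((((continuousOn_curveValue 1 ht hτ.2).sub (continuousOn_polylogSeries_neg 1 ht hτ1.le)).sub
      (continuousOn_const.mul hlc)).sub (continuousOn_const.mul (hlc.pow 3)))
    (fun s hs => by
      have s0 : 0 < s := ht.trans_le hs.1
      have s1 : s * (1 + s) < 1 := by nlinarith [hs.2]
      have sI : s ∈ Ioo (0 : ℝ) 1 := ⟨s0, hs.2.trans hτ.2⟩
      refine ((((hasDerivAt_curveValue sI 1).fun_sub
        (hasDerivAt_polylogSeries_neg 2 s0 s1)).fun_sub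
        ((hasDerivAt_log_curve s0).const_mul ((Real.pi : ℂ) ^ 2 / 6))).fun_sub
        (((hasDerivAt_log_curve s0).fun_pow 3).const_mul (1 / 6))).congr_deriv ?_
      rw [show 1 + 1 = 2 from rfl, curveValue_two s0 s1.le]
      push_cast
      ring)
  have h2 := curveValue_threshold hτ hτ1 1
  simp only [Nat.reduceAdd] at h2
  simp only [hτ1, h2, Real.log_one] at key
  have e : ((-1 : ℝ) : ℂ) = -1 := by norm_num
  rw [e, Complex.ofReal_zero] at key
  linear_combination key

/-! ### The relations hold along the tangential base point -/

theorem tendsto_baseReal (i : Fin 9) (hi : i ≠ 6) :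
    Filter.Tendsto (fun t => baseReal t i) (nhdsWithin 0 (Ioi 0))
      (nhds (if i = 5 then 1 else 0)) := by
  refine tendsto_nhdsWithin_of_tendsto_nhds ?_
  have : ContinuousAt (fun t : ℝ => baseReal t i) 0 := by
    match i, hi with
    | 0, _ => exact continuousAt_id.div (by fun_prop) (by norm_num)
    | 1, _ => exact continuousAt_id.pow 3
    | 2, _ => exact continuousAt_id
    | 3, _ => exact continuousAt_id.div (by fun_prop) (by norm_num)
    | 4, _ => exact ((continuousAt_id.pow 2).div (by fun_prop) (by norm_num)).neg
    | 5, _ => exact continuousAt_const.div (by fun_prop) (by norm_num)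
    | 7, _ => exact continuousAt_id.pow 2
    | 8, _ => exact continuousAt_id
  have e : baseReal 0 i = if i = 5 then 1 else 0 := by
    match i, hi with
    | 0, _ | 1, _ | 2, _ | 3, _ | 4, _ | 5, _ | 7, _ | 8, _ =>
      simp [baseReal]
  rw [← e]
  exact this

theorem abs_baseReal_le {t : ℝ} (ht : t ∈ Ioo (0 : ℝ) 1) (i : Fin 9) (hi : i ≠ 6) :
    |baseReal t i| ≤ 1 := by
  obtain ⟨h0, h1⟩ := ht
  match i, hi with
  | 0, _ =>
    change |t / (1 + t) ^ 2| ≤ 1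
    rw [abs_of_pos (by positivity), div_le_one (by positivity)]
    nlinarith
  | 1, _ =>
    change |t ^ 3| ≤ 1
    rw [abs_of_pos (by positivity)]
    exact pow_le_one₀ h0.le h1.le
  | 2, _ =>
    change |t| ≤ 1
    rw [abs_of_pos h0]
    exact h1.le
  | 3, _ =>
    change |t / (1 + t)| ≤ 1
    rw [abs_of_pos (by positivity), div_le_one (by positivity)]
    linarith
  | 4, _ =>
    change |-(t ^ 2 / (1 + t))| ≤ 1
    rw [abs_neg, abs_of_pos (by positivity), div_le_one (by positivity)]
    nlinarith
  | 5, _ =>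
    change |1 / (1 + t)| ≤ 1
    rw [abs_of_pos (by positivity), div_le_one (by positivity)]
    linarith
  | 7, _ =>
    change |t ^ 2| ≤ 1
    rw [abs_of_pos (by positivity)]
    exact pow_le_one₀ h0.le h1.le
  | 8, _ =>
    change |t| ≤ 1
    rw [abs_of_pos h0]
    exact h1.le

theorem tendsto_polylogSeries_baseReal (k : ℕ) (i : Fin 9) (hi : i ≠ 6) :
    Filter.Tendsto (fun t => polylogSeries (k + 2) ((baseReal t i : ℝ) : ℂ))
      (nhdsWithin 0 (Ioi 0)) (nhds (if i = 5 then polylogSeries (k + 2) 1 else 0)) := by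
  have h := tendsto_polylogSeries k (tendsto_baseReal i hi)
    (Filter.eventually_of_mem (Ioo_mem_nhdsGT one_pos) fun t ht => abs_baseReal_le ht i hi)
    (by split_ifs <;> norm_num)
  convert h using 2
  split_ifs
  · rw [Complex.ofReal_one]
  · rw [Complex.ofReal_zero, polylogSeries_zero_right]

theorem tendsto_polylogSeries_neg (k : ℕ) :
    Filter.Tendsto (fun t : ℝ => polylogSeries (k + 2) ((-(t * (1 + t)) : ℝ) : ℂ))
      (nhdsWithin 0 (Ioi 0)) (nhds 0) := by
  have h0 : Filter.Tendsto (fun t : ℝ => -(t * (1 + t))) (nhdsWithin 0 (Ioi 0)) (nhds 0) := by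
    refine tendsto_nhdsWithin_of_tendsto_nhds ?_
    have : ContinuousAt (fun t : ℝ => -(t * (1 + t))) 0 := by fun_prop
    simpa [ContinuousAt] using this
  have h := tendsto_polylogSeries k h0
    (Filter.eventually_of_mem (Ioo_mem_nhdsGT (show (0 : ℝ) < 1 / 2 by norm_num)) fun t ht => by
      have := ht.1
      rw [abs_neg, abs_of_pos (by positivity)]
      nlinarith [ht.2]) (by norm_num)
  rwa [Complex.ofReal_zero, polylogSeries_zero_right] at h

theorem tendsto_log_one_add :
    Filter.Tendsto (fun t : ℝ => ((Real.log (1 + t) : ℝ) : ℂ)) (nhdsWithin 0 (Ioi 0))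
      (nhds 0) := by
  refine tendsto_nhdsWithin_of_tendsto_nhds ?_
  have : ContinuousAt (fun t : ℝ => ((Real.log (1 + t) : ℝ) : ℂ)) 0 :=
    Complex.continuous_ofReal.continuousAt.comp
      (ContinuousAt.log (by fun_prop) (by norm_num))
  simpa [ContinuousAt] using this

/-- Comparison with t log t, as 0 ≤ log(1 + t) ≤ t. This controls every product involving log t that
survives inversion. -/
theorem tendsto_log_mul_log_one_add :
    Filter.Tendsto (fun t : ℝ => ((Real.log t : ℝ) : ℂ) * ((Real.log (1 + t) : ℝ) : ℂ))
      (nhdsWithin 0 (Ioi 0)) (nhds 0) := by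
  have h : Filter.Tendsto (fun t : ℝ => Real.log t * t) (nhdsWithin 0 (Ioi 0)) (nhds 0) :=
    (by simpa only [Real.rpow_one] using tendsto_log_mul_rpow_nhdsGT_zero (r := 1) zero_lt_one)
  rw [tendsto_zero_iff_norm_tendsto_zero] at h ⊢
  refine squeeze_zero' (Filter.Eventually.of_forall fun t => norm_nonneg _) ?_ h
  filter_upwards [self_mem_nhdsWithin] with t ht
  have ht : 0 < t := ht
  rw [norm_mul, norm_mul, Complex.norm_real, Complex.norm_real]
  refine mul_le_mul_of_nonneg_left ?_ (norm_nonneg _)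
  rw [Real.norm_of_nonneg (Real.log_nonneg (by linarith)), Real.norm_of_nonneg ht.le]
  linarith [Real.log_le_sub_one_of_pos (show 0 < 1 + t by linarith)]

/-- A constant equals its limit at 0, so the explicit form is needed only for small `t`, where the
inversion relations apply. -/
theorem eq_zero_of_tendsto {g : UnitOpen → ℂ} (hg : ∀ s t, g s = g t) {r : ℝ → ℂ}
    (hr : Filter.Tendsto r (nhdsWithin 0 (Ioi 0)) (nhds 0))
    (h : ∀ t : UnitOpen, (t : ℝ) * (1 + t) ≤ 1 → g t = r t) (t : UnitOpen) : g t = 0 := by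
  refine tendsto_nhds_unique ?_ hr
  refine (tendsto_const_nhds (x := g t)).congr' ?_
  filter_upwards [Ioo_mem_nhdsGT (show (0 : ℝ) < 1 / 2 by norm_num)] with s hs
  rw [← h ⟨s, hs.1, by linarith [hs.2]⟩ (by nlinarith [hs.1, hs.2])]
  exact hg _ _

theorem baseValue_six (t : UnitOpen) (k : ℕ) : baseValue t 6 k = curveValue t k := by
  rw [curveValue, dif_pos t.2]

theorem log_curve (t : UnitOpen) :
    ((Real.log (t * (1 + t)) : ℝ) : ℂ) =
      ((Real.log t : ℝ) : ℂ) + ((Real.log (1 + t) : ℝ) : ℂ) := by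
  rw [Real.log_mul t.2.1.ne' (by linarith [t.2.1]), Complex.ofReal_add]

theorem weightTwo_baseValue (t : UnitOpen) : weightTwo (baseValue t) = 0 := by
  have hc : ∀ j s t, weightTwo (baseValue s) j = weightTwo (baseValue t) j := fun j s t =>
    congrFun (weightTwo_constant baseV.continuous isLocalLift_baseValue weightOne_baseValue s t) j
  have hS : ∀ i (t : UnitOpen), i ≠ 6 →
      baseValue t i 2 = polylogSeries 2 ((baseReal t i : ℝ) : ℂ) :=
    fun i t hi => baseValue_succ t i (Or.inl hi) 1
  have hl := fun i hi => tendsto_polylogSeries_baseReal 0 i hi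
  simp only [zero_add] at hl
  have hn := tendsto_polylogSeries_neg 0
  have n0 := hl 0 (by decide)
  have n1 := hl 1 (by decide)
  have n2 := hl 2 (by decide)
  have n3 := hl 3 (by decide)
  have n4 := hl 4 (by decide)
  have n5 := hl 5 (by decide)
  have n7 := hl 7 (by decide)
  have n8 := hl 8 (by decide)
  have l1 := tendsto_log_one_add
  have l2 := tendsto_log_mul_log_one_add
  funext j
  match j with
  | 0 =>
    refine eq_zero_of_tendsto (g := fun t => weightTwo (baseValue t) 0) (hc 0)
      (r := fun t => polylogSeries 2 ((baseReal t 0 : ℝ) : ℂ) +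
        polylogSeries 2 ((baseReal t 1 : ℝ) : ℂ) + polylogSeries 2 ((baseReal t 2 : ℝ) : ℂ) -
        2 * polylogSeries 2 ((baseReal t 3 : ℝ) : ℂ) -
        2 * polylogSeries 2 ((baseReal t 4 : ℝ) : ℂ) -
        2 * polylogSeries 2 ((baseReal t 7 : ℝ) : ℂ)) ?_ (fun t ht => ?_) t
    · have := ((((n0.add n1).add n2).sub (n3.const_mul 2)).sub (n4.const_mul 2)).sub
        (n7.const_mul 2)
      simpa using this
    · simp only [weightTwo, Matrix.cons_val]
      rw [hS 0 t (by decide), hS 1 t (by decide), hS 2 t (by decide), hS 3 t (by decide),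
        hS 4 t (by decide), hS 7 t (by decide)]
  | 1 =>
    refine eq_zero_of_tendsto (g := fun t => weightTwo (baseValue t) 1) (hc 1)
      (r := fun t => polylogSeries 2 ((baseReal t 1 : ℝ) : ℂ) -
        polylogSeries 2 ((baseReal t 0 : ℝ) : ℂ) - polylogSeries 2 ((baseReal t 2 : ℝ) : ℂ) +
        2 * polylogSeries 2 ((baseReal t 3 : ℝ) : ℂ) -
        2 * polylogSeries 2 ((baseReal t 8 : ℝ) : ℂ) -
        2 * polylogSeries 2 ((-(t * (1 + t)) : ℝ) : ℂ) -
        ((Real.log (1 + t) : ℝ) : ℂ) ^ 2) ?_ (fun t ht => ?_) t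
    · have := (((((n1.sub n0).sub n2).add (n3.const_mul 2)).sub (n8.const_mul 2)).sub
        (hn.const_mul 2)).sub (l1.pow 2)
      simpa using this
    · simp only [weightTwo, Matrix.cons_val]
      rw [hS 0 t (by decide), hS 1 t (by decide), hS 2 t (by decide), hS 3 t (by decide),
        hS 8 t (by decide), baseValue_six, curveValue_two t.2.1 ht, log_curve,
        baseValue_five_zero, baseValue_eight_zero]
      -- The squares of log t cancel, and the π²/3 of the relation cancels the one produced by
      -- inversion.
      ring
  | 2 =>
    refine eq_zero_of_tendsto (g := fun t => weightTwo (baseValue t) 2) (hc 2)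
      (r := fun t => 2 * (polylogSeries 2 ((baseReal t 0 : ℝ) : ℂ) -
        polylogSeries 2 ((baseReal t 3 : ℝ) : ℂ) - polylogSeries 2 ((baseReal t 4 : ℝ) : ℂ) -
        polylogSeries 2 ((baseReal t 5 : ℝ) : ℂ) + (Real.pi : ℂ) ^ 2 / 6 +
        polylogSeries 2 ((-(t * (1 + t)) : ℝ) : ℂ) +
        ((Real.log t : ℝ) : ℂ) * ((Real.log (1 + t) : ℝ) : ℂ)) +
        ((Real.log (1 + t) : ℝ) : ℂ) ^ 2) ?_ (fun t ht => ?_) t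
    -- The limit π²/6 of the dilogarithm at 1/(1 + t) cancels the constant of the inversion
    -- relation.
    · have := (((((((n0.sub n3).sub n4).sub n5).add_const ((Real.pi : ℂ) ^ 2 / 6)).add hn).add
        l2).const_mul 2).add (l1.pow 2)
      simpa [polylogSeries_two_one] using this
    · simp only [weightTwo, Matrix.cons_val]
      rw [hS 0 t (by decide), hS 3 t (by decide), hS 4 t (by decide),
        hS 5 t (by decide), baseValue_six, curveValue_two t.2.1 ht, log_curve,
        baseValue_eight_zero]
      ring

theorem weightThree_baseValue (t : UnitOpen) : weightThree (baseValue t) = 0 := by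
  have hS : ∀ i (t : UnitOpen), i ≠ 6 →
      baseValue t i 3 = polylogSeries 3 ((baseReal t i : ℝ) : ℂ) :=
    fun i t hi => baseValue_succ t i (Or.inl hi) 2
  have hl := fun i hi => tendsto_polylogSeries_baseReal 1 i hi
  simp only [Nat.reduceAdd] at hl
  have hn := tendsto_polylogSeries_neg 1
  have n0 := hl 0 (by decide)
  have n1 := hl 1 (by decide)
  have n2 := hl 2 (by decide)
  have n3 := hl 3 (by decide)
  have n4 := hl 4 (by decide)
  have n5 := hl 5 (by decide)
  have n7 := hl 7 (by decide)
  have n8 := hl 8 (by decide)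
  have l1 := tendsto_log_one_add
  have l2 := tendsto_log_mul_log_one_add
  refine eq_zero_of_tendsto (g := fun t => weightThree (baseValue t))
    (weightThree_constant baseV.continuous isLocalLift_baseValue weightOne_baseValue
      weightTwo_baseValue)
    (r := fun t => polylogSeries 3 ((baseReal t 0 : ℝ) : ℂ) +
        polylogSeries 3 ((baseReal t 1 : ℝ) : ℂ) + polylogSeries 3 ((baseReal t 2 : ℝ) : ℂ) -
        2 * polylogSeries 3 ((baseReal t 3 : ℝ) : ℂ) -
        2 * polylogSeries 3 ((baseReal t 4 : ℝ) : ℂ) -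
        2 * polylogSeries 3 ((baseReal t 5 : ℝ) : ℂ) -
        2 * polylogSeries 3 ((baseReal t 7 : ℝ) : ℂ) -
        2 * polylogSeries 3 ((baseReal t 8 : ℝ) : ℂ) -
        2 * polylogSeries 3 ((-(t * (1 + t)) : ℝ) : ℂ) -
        (Real.pi : ℂ) ^ 2 / 3 * ((Real.log (1 + t) : ℝ) : ℂ) -
        ((Real.log t : ℝ) : ℂ) * ((Real.log (1 + t) : ℝ) : ℂ) * ((Real.log (1 + t) : ℝ) : ℂ) -
        1 / 3 * ((Real.log (1 + t) : ℝ) : ℂ) ^ 3 + 2 * riemannZeta 3) ?_ (fun t ht => ?_) t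
  · have := (((((((((((n0.add n1).add n2).sub (n3.const_mul 2)).sub (n4.const_mul 2)).sub
      (n5.const_mul 2)).sub (n7.const_mul 2)).sub (n8.const_mul 2)).sub (hn.const_mul 2)).sub
      (l1.const_mul ((Real.pi : ℂ) ^ 2 / 3))).sub (l2.mul l1)).sub
      ((l1.pow 3).const_mul (1 / 3))).add_const (2 * riemannZeta 3)
    simpa [polylogSeries_three_one] using this
  · simp only [weightThree]
    rw [hS 0 t (by decide), hS 1 t (by decide), hS 2 t (by decide), hS 3 t (by decide),
      hS 4 t (by decide), hS 5 t (by decide), hS 7 t (by decide), hS 8 t (by decide),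
      baseValue_six, curveValue_three t.2.1 ht, log_curve, baseValue_five_zero,
      baseValue_eight_zero]
    -- Put L = log t and l = log(1 + t). Inversion contributes -(L + l)³/3 - π²(L + l)/3, and the
    -- logarithmic terms of the relation are L²l + π²L/3 + L³/3. All pure powers of L and the term
    -- L²l cancel, leaving -Ll² - l³/3 - π²l/3, which tends to 0; 2ζ(3) cancels the limit of the
    -- sixth trilogarithm.
    ring

/-! ### Transport along γ₀ -/

/-- The nine paths `δ · f(γ₀)`. -/
def gammaNine {P : NonFano} (γ₀ : TangentialPath baseV P) (i : Fin 9) :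
    TangentialPath base01 (nine i P) :=
  (deltaNine i).comp (γ₀.map (nine i))

/-- The nine lifts along the images of one representative of γ₀ start at the base values, where all
three layers vanish. Constancy along the unit interval carries this to the end point, where the
lifts are the transports along δᵢ · fᵢ(γ₀). -/
theorem weightThree_eq_zero {P : NonFano} (γ₀ : TangentialPath baseV P) :
    weightThree (fun i => transport ((gammaNine γ₀ i).cls half) (integralsStart half)) = 0 := by
  obtain ⟨p, hp⟩ : ∃ p : Path (baseV half) P, Path.Homotopic.Quotient.mk p = γ₀.cls half := by
    induction γ₀.cls half using Path.Homotopic.Quotient.ind with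
    | mk p => exact ⟨p, rfl⟩
  choose Φ hΦ hΦ0 using fun i => exists_isLocalLift (p.map (nine i).continuous) (baseValue half i)
  have hlift : ∀ i, IsLocalLift (fun s => nine i (p s)) (fun s => Φ i s) := hΦ
  have h0 : (fun i => Φ i 0) = baseValue half := funext hΦ0
  have h1 : (fun i => transport ((gammaNine γ₀ i).cls half) (integralsStart half)) =
      fun i => Φ i 1 := by
    funext i
    rw [gammaNine, transport_comp, ← transport_mk _ (hΦ i), hΦ0]
    change transport ((γ₀.cls half).map (nine i)) _ = _
    rw [← hp]
    rfl
  have w1 : ∀ s, weightOne (fun i => Φ i s) = 0 := fun s => by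
    rw [weightOne_constant (Φ := fun s i => Φ i s) p.continuous hlift s 0, h0,
      weightOne_baseValue]
  have w2 : ∀ s, weightTwo (fun i => Φ i s) = 0 := fun s => by
    rw [weightTwo_constant (Φ := fun s i => Φ i s) p.continuous hlift w1 s 0, h0,
      weightTwo_baseValue]
  rw [h1, weightThree_constant (Φ := fun s i => Φ i s) p.continuous hlift w1 w2 1 0, h0,
    weightThree_baseValue]

end SpenceKummer

end


theorem theorem1 (x y : ℂ)
    (hxy : x * y * (1 - x) * (1 - y) * (x - y) * (1 - x * y) ≠ 0)
    (γ₀ : SpenceKummer.TangentialPath SpenceKummer.baseV (⟨(x, y), hxy⟩ : SpenceKummer.NonFano)) :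
    SpenceKummer.Li 3 (SpenceKummer.f₁ ⟨(x, y), hxy⟩) (SpenceKummer.γ₁ γ₀)
      + SpenceKummer.Li 3 (SpenceKummer.f₂ ⟨(x, y), hxy⟩) (SpenceKummer.γ₂ γ₀)
      + SpenceKummer.Li 3 (SpenceKummer.f₃ ⟨(x, y), hxy⟩) (SpenceKummer.γ₃ γ₀)
      - 2 * SpenceKummer.Li 3 (SpenceKummer.f₄ ⟨(x, y), hxy⟩) (SpenceKummer.γ₄ γ₀)
      - 2 * SpenceKummer.Li 3 (SpenceKummer.f₅ ⟨(x, y), hxy⟩) (SpenceKummer.γ₅ γ₀)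
      - 2 * SpenceKummer.Li 3 (SpenceKummer.f₆ ⟨(x, y), hxy⟩) (SpenceKummer.γ₆ γ₀)
      - 2 * SpenceKummer.Li 3 (SpenceKummer.f₇ ⟨(x, y), hxy⟩) (SpenceKummer.γ₇ γ₀)
      - 2 * SpenceKummer.Li 3 (SpenceKummer.f₈ ⟨(x, y), hxy⟩) (SpenceKummer.γ₈ γ₀)
      - 2 * SpenceKummer.Li 3 (SpenceKummer.f₉ ⟨(x, y), hxy⟩) (SpenceKummer.γ₉ γ₀)
      + 2 * riemannZeta 3 =
    SpenceKummer.log (SpenceKummer.f₉ ⟨(x, y), hxy⟩) (SpenceKummer.γ₉ γ₀) ^ 2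
        * SpenceKummer.log (SpenceKummer.f₆ ⟨(x, y), hxy⟩) (SpenceKummer.γ₆ γ₀)
      - (Real.pi : ℂ) ^ 2 / 3
        * SpenceKummer.log (SpenceKummer.f₉ ⟨(x, y), hxy⟩) (SpenceKummer.γ₉ γ₀)
      - 1 / 3 * SpenceKummer.log (SpenceKummer.f₉ ⟨(x, y), hxy⟩) (SpenceKummer.γ₉ γ₀) ^ 3 := by

  have h := SpenceKummer.weightThree_eq_zero γ₀
  simp only [SpenceKummer.weightThree, ← SpenceKummer.Li_eq_transport 2,
    ← SpenceKummer.log_eq_transport] at h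
  -- The index of `gammaNine` starts at 0 and that of the named paths at 1; otherwise they agree by
  -- unfolding.
  change SpenceKummer.Li 3 _ (SpenceKummer.γ₁ γ₀) + SpenceKummer.Li 3 _ (SpenceKummer.γ₂ γ₀)
    + SpenceKummer.Li 3 _ (SpenceKummer.γ₃ γ₀) - 2 * SpenceKummer.Li 3 _ (SpenceKummer.γ₄ γ₀)
    - 2 * SpenceKummer.Li 3 _ (SpenceKummer.γ₅ γ₀) - 2 * SpenceKummer.Li 3 _ (SpenceKummer.γ₆ γ₀)
    - 2 * SpenceKummer.Li 3 _ (SpenceKummer.γ₇ γ₀) - 2 * SpenceKummer.Li 3 _ (SpenceKummer.γ₈ γ₀)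
    - 2 * SpenceKummer.Li 3 _ (SpenceKummer.γ₉ γ₀)
    - SpenceKummer.log _ (SpenceKummer.γ₉ γ₀) ^ 2 * SpenceKummer.log _ (SpenceKummer.γ₆ γ₀)
    + (Real.pi : ℂ) ^ 2 / 3 * SpenceKummer.log _ (SpenceKummer.γ₉ γ₀)
    + 1 / 3 * SpenceKummer.log _ (SpenceKummer.γ₉ γ₀) ^ 3 + 2 * riemannZeta 3 = 0 at h
  linear_combination h
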